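/- Let $d\ge 1$ and $p\in(0,1)$. Let $b$ be an invertible real $d\times d$ matrix and let $a_1,a_2,\dots$ be invertible real $d\times d$ matrices that are expanding: $\|a_j^{-1}\|\to 0$ as $j\to\infty$ (operator norm). Let $L^p=L^p(\mathbb R^d)$ be the space of complex-valued functions with $\|f\|_p=(\int_{\mathbb R^d}|f|^p\,dx)^{1/p}<\infty$, with the metric $\|f-g\|_p^p$, and let $\ell^p=\ell^p(\mathbb Z_+\times\mathbb Z^d)$, with $\mathbb Z_+=\{1,2,3,\dots\}$, be the space of complex sequences $c=\{c_{j,k}\}$ with $\|c\|_{\ell^p}=(\sum_{j>0}\sum_{k\in\mathbb Z^d}|c_{j,k}|^p)^{1/p}<\infty$, with the metric $\|c-\tilde c\|_{\ell^p}^p$. For $\psi\in L^p$ put $\psi_{j,k}(x)=|\det a_j|^{1/p}\,\psi(a_jx-bk)$ and $$Sc=\sum_{j>0}\sum_{k\in\mathbb Z^d}c_{j,k}\psi_{j,k},\qquad c\in\ell^p;$$ this series converges absolutely almost everywhere and $Sc\in L^p$. Theorem 6 (More synthesis onto $L^p$). Let $\psi\in L^p\cap L^1$ be real-valued and not a.e.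 zero, and suppose that its negative part or its positive part is bounded with compact support. Then $S:\ell^p(\mathbb Z_+\times\mathbb Z^d)\to L^p$ is open and surjective. Moreover there is a constant $C$, depending only on $\psi$, $b$ and $p$ (and not on the dilations $a_j$), such that for every $f\in L^p$ there is a sequence $c\in\ell^p(\mathbb Z_+\times\mathbb Z^d)$ with $Sc=f$ and $\|c\|_{\ell^p}\le C\|f\|_p$. -/

import Mathlib

open MeasureTheory Filter Topology
open scoped ENNReal Matrix

noncomputable section

namespace AffineSynthesis

/-- The Euclidean space `ℝ^d`, carrying Lebesgue measure `volume`. -/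
abbrev RSpace (d : ℕ) := EuclideanSpace ℝ (Fin d)

/-- The index set `ℤ_+ × ℤ^d`, where `ℤ_+` denotes the positive integers. -/
abbrev Index (d : ℕ) := ℕ+ × (Fin d → ℤ)

/-- The space `L^p(ℝ^d)` of (classes of) complex valued functions;
`‖f‖ = (∫ |f|^p dx)^(1/p)` when `0 < p`. -/
abbrev LpSpace (d : ℕ) (p : ℝ) := Lp ℂ (ENNReal.ofReal p) (volume : Measure (RSpace d))

/-- The space `ℓ^p(ℤ_+ × ℤ^d)` of complex sequences;
`‖c‖ = (∑_{j,k} |c_{j,k}|^p)^(1/p)` when `0 < p`. -/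
abbrev EllpSpace (d : ℕ) (p : ℝ) := lp (fun _ : Index d => ℂ) (ENNReal.ofReal p)

/-- The dilation matrices `a_j`, `j > 0`, are invertible, and the operator norms (for the
Euclidean norm on `ℝ^d`) of their inverses tend to `0` as `j → ∞`. -/
def IsExpanding {d : ℕ} (a : ℕ+ → Matrix (Fin d) (Fin d) ℝ) : Prop :=
  (∀ j, IsUnit (a j)) ∧
    Tendsto (fun j => ‖Matrix.toEuclideanCLM (n := Fin d) (𝕜 := ℝ) (a j)⁻¹‖) atTop (𝓝 0)

/-- A real function on `ℝ^d` is (up to a null set) bounded with compact support. -/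
def IsBoundedCompactlySupported {d : ℕ} (g : RSpace d → ℝ) : Prop :=
  (∃ M : ℝ, ∀ᵐ x, |g x| ≤ M) ∧ ∃ K : Set (RSpace d), IsCompact K ∧ ∀ᵐ x, x ∉ K → g x = 0

/-- An integer vector `k ∈ ℤ^d` as a point of `ℝ^d`. -/
def latticePoint {d : ℕ} (k : Fin d → ℤ) : RSpace d := WithLp.toLp 2 (fun i => (k i : ℝ))

/-- The function `x ↦ |det A|^(1/p) ψ(A x - b k)`; with `A = a_j` this is `ψ_{j,k}`. -/
def affineAtom {d : ℕ} (p : ℝ) (A b : Matrix (Fin d) (Fin d) ℝ) (ψ : RSpace d → ℂ)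
    (k : Fin d → ℤ) : RSpace d → ℂ :=
  fun x => ((|A.det| ^ (1 / p) : ℝ) : ℂ) *
    ψ (Matrix.toEuclideanLin A x - Matrix.toEuclideanLin b (latticePoint k))

/-- The synthesis series `∑_{j>0} ∑_{k ∈ ℤ^d} c_{j,k} ψ_{j,k}(x)`, as an unconditional pointwise
sum. -/
def synthesisFun {d : ℕ} (p : ℝ) (a : ℕ+ → Matrix (Fin d) (Fin d) ℝ)
    (b : Matrix (Fin d) (Fin d) ℝ) (ψ : RSpace d → ℂ) (c : Index d → ℂ) : RSpace d → ℂ :=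
  fun x => ∑' i : Index d, c i * affineAtom p (a i.1) b ψ i.2 x

section Helpers

theorem rpow_sum_le {ι : Type*} {p : ℝ} (hp : 0 < p) (hp1 : p ≤ 1) (s : Finset ι)
    (f : ι → ℝ≥0∞) : (∑ i ∈ s, f i) ^ p ≤ ∑ i ∈ s, f i ^ p := by
  classical
  induction s using Finset.induction_on with
  | empty => simp [hp]
  | insert i s hi ih =>
    rw [Finset.sum_insert hi, Finset.sum_insert hi]
    exact (ENNReal.rpow_add_le_add_rpow _ _ hp.le hp1).trans (by gcongr)

theorem rpow_tsum_le {ι : Type*} {p : ℝ} (hp : 0 < p) (hp1 : p ≤ 1)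
    (f : ι → ℝ≥0∞) : (∑' i, f i) ^ p ≤ ∑' i, f i ^ p := by
  have h : Tendsto (fun s : Finset ι => (∑ i ∈ s, f i) ^ p) atTop (𝓝 ((∑' i, f i) ^ p)) :=
    (ENNReal.continuous_rpow_const.tendsto _).comp ENNReal.summable.hasSum
  exact le_of_tendsto h (Eventually.of_forall fun s =>
    (rpow_sum_le hp hp1 s f).trans (ENNReal.sum_le_tsum s))

theorem affine_zero {d : ℕ} {p : ℝ} (hp : 0 < p) {A : Matrix (Fin d) (Fin d) ℝ}
    (hA : A.det = 0) (b : Matrix (Fin d) (Fin d) ℝ) (ψ : RSpace d → ℂ) (k : Fin d → ℤ) :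
    affineAtom p A b ψ k = 0 := by
  ext x
  have : (0 : ℝ) ^ (1 / p) = 0 := Real.zero_rpow (by positivity)
  simp only [affineAtom, hA, abs_zero, this, Complex.ofReal_zero, zero_mul, Pi.zero_apply]

theorem map_toEuclideanLin {d : ℕ} {A : Matrix (Fin d) (Fin d) ℝ} (hA : A.det ≠ 0) :
    Measure.map (Matrix.toEuclideanLin A) (volume : Measure (RSpace d))
      = ENNReal.ofReal |A.det⁻¹| • volume := by
  have h : LinearMap.det (Matrix.toEuclideanLin A) = A.det := LinearMap.det_toLpLin 2 A
  rw [Measure.map_linearMap_addHaar_eq_smul_addHaar _ (by rwa [h]), h]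

theorem aestronglyMeasurable_affine {d : ℕ} {p : ℝ} (hp : 0 < p)
    (A b : Matrix (Fin d) (Fin d) ℝ) {ψ : RSpace d → ℂ}
    (hψ : AEStronglyMeasurable ψ volume) (k : Fin d → ℤ) :
    AEStronglyMeasurable (affineAtom p A b ψ k) volume := by
  by_cases hA : A.det = 0
  · rw [affine_zero hp hA]; exact aestronglyMeasurable_zero
  · have h : LinearMap.det (Matrix.toEuclideanLin A) = A.det := LinearMap.det_toLpLin 2 A
    have hq := Measure.LinearMap.quasiMeasurePreserving (volume : Measure (RSpace d))
      (Matrix.toEuclideanLin A) (by rwa [h])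
    have hq2 := (measurePreserving_sub_right (volume : Measure (RSpace d))
      (Matrix.toEuclideanLin b (latticePoint k))).quasiMeasurePreserving.comp hq
    exact (hψ.comp_quasiMeasurePreserving hq2).const_mul _

theorem lintegral_affine_le {d : ℕ} {p : ℝ} (hp : 0 < p)
    (A b : Matrix (Fin d) (Fin d) ℝ) {ψ : RSpace d → ℂ}
    (hψ : AEStronglyMeasurable ψ volume) (k : Fin d → ℤ) :
    ∫⁻ x, ‖affineAtom p A b ψ k x‖ₑ ^ p ≤ ∫⁻ x, ‖ψ x‖ₑ ^ p := by
  by_cases hA : A.det = 0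
  · rw [affine_zero hp hA]; simp [hp]
  · set v := Matrix.toEuclideanLin b (latticePoint k) with hv
    set φ : RSpace d → ℝ≥0∞ := fun y => ‖ψ (y - v)‖ₑ ^ p with hφ
    have hφm : AEMeasurable φ volume :=
      ((hψ.comp_quasiMeasurePreserving
        (measurePreserving_sub_right (volume : Measure (RSpace d)) v).quasiMeasurePreserving
        ).enorm).pow_const p
    have hmeas : Measurable (Matrix.toEuclideanLin A : RSpace d → RSpace d) :=
      (LinearMap.continuous_of_finiteDimensional _).measurable
    have e1 : ∀ x, ‖affineAtom p A b ψ k x‖ₑ ^ p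
        = ENNReal.ofReal |A.det| * φ (Matrix.toEuclideanLin A x) := by
      intro x
      have : ‖((|A.det| ^ (1 / p) : ℝ) : ℂ)‖ₑ ^ p = ENNReal.ofReal |A.det| := by
        rw [← ofReal_norm, Complex.norm_real, Real.norm_of_nonneg (by positivity),
          ENNReal.ofReal_rpow_of_nonneg (by positivity) hp.le, ← Real.rpow_mul (abs_nonneg _),
          one_div, inv_mul_cancel₀ hp.ne', Real.rpow_one]
      rw [affineAtom, enorm_mul, ENNReal.mul_rpow_of_nonneg _ _ hp.le, this]
    have e2 : ∫⁻ x, φ (Matrix.toEuclideanLin A x)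
        = ENNReal.ofReal |A.det⁻¹| * ∫⁻ y, φ y := by
      rw [← lintegral_map' _ hmeas.aemeasurable, map_toEuclideanLin hA, lintegral_smul_measure,
        smul_eq_mul]
      rw [map_toEuclideanLin hA]
      exact hφm.smul_measure _
    have e3 : ∫⁻ y, φ y = ∫⁻ y, ‖ψ y‖ₑ ^ p :=
      lintegral_sub_right_eq_self (fun y => ‖ψ y‖ₑ ^ p) v
    simp_rw [e1]
    rw [lintegral_const_mul' _ _ ENNReal.ofReal_ne_top, e2, e3, ← mul_assoc,
      ← ENNReal.ofReal_mul (abs_nonneg _), ← abs_mul, mul_inv_cancel₀ hA, abs_one,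
      ENNReal.ofReal_one, one_mul]

theorem lintegral_rpow_lt_top {d : ℕ} {p : ℝ} (hp : 0 < p) {ψ : RSpace d → ℂ}
    (hψ : MemLp ψ (ENNReal.ofReal p) volume) : ∫⁻ x, ‖ψ x‖ₑ ^ p < ∞ := by
  have := lintegral_rpow_enorm_lt_top_of_eLpNorm_lt_top (by simpa using hp)
    ENNReal.ofReal_ne_top hψ.2
  rwa [ENNReal.toReal_ofReal hp.le] at this

theorem lintegral_synthesis_lt_top {d : ℕ} {p : ℝ} (hp : 0 < p) (hp1 : p ≤ 1)
    (a : ℕ+ → Matrix (Fin d) (Fin d) ℝ) (b : Matrix (Fin d) (Fin d) ℝ) {ψ : RSpace d → ℂ}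
    (hψ : MemLp ψ (ENNReal.ofReal p) volume) (c : EllpSpace d p) :
    ∫⁻ x, (∑' i : Index d, ‖c i * affineAtom p (a i.1) b ψ i.2 x‖ₑ) ^ p < ∞ := by
  have hc : ∑' i : Index d, ‖c i‖ₑ ^ p < ∞ := by
    have h := (lp.memℓp c).summable (by rwa [ENNReal.toReal_ofReal hp.le])
    rw [ENNReal.toReal_ofReal hp.le] at h
    have h2 : ∀ i, ‖c i‖ₑ ^ p = ENNReal.ofReal (‖c i‖ ^ p) := fun i => by
      rw [← ENNReal.ofReal_rpow_of_nonneg (norm_nonneg _) hp.le, ofReal_norm]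
    simp_rw [h2]
    rw [← ENNReal.ofReal_tsum_of_nonneg (fun i => by positivity) h]
    exact ENNReal.ofReal_lt_top
  calc ∫⁻ x, (∑' i : Index d, ‖c i * affineAtom p (a i.1) b ψ i.2 x‖ₑ) ^ p
      ≤ ∫⁻ x, ∑' i : Index d, ‖c i‖ₑ ^ p * ‖affineAtom p (a i.1) b ψ i.2 x‖ₑ ^ p := by
        refine lintegral_mono fun x => (rpow_tsum_le hp hp1 _).trans (le_of_eq ?_)
        simp_rw [enorm_mul, ENNReal.mul_rpow_of_nonneg _ _ hp.le]
    _ = ∑' i : Index d, ‖c i‖ₑ ^ p * ∫⁻ x, ‖affineAtom p (a i.1) b ψ i.2 x‖ₑ ^ p := by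
        have hm : ∀ i : Index d, AEMeasurable
            (fun x => ‖affineAtom p (a i.1) b ψ i.2 x‖ₑ ^ p) volume := fun i =>
          (aestronglyMeasurable_affine hp _ _ hψ.1 _).enorm.pow_const p
        rw [lintegral_tsum fun i => (hm i).const_mul _]
        exact tsum_congr fun i => lintegral_const_mul'' _ (hm i)
    _ ≤ ∑' i : Index d, ‖c i‖ₑ ^ p * ∫⁻ x, ‖ψ x‖ₑ ^ p := by
        refine ENNReal.tsum_le_tsum fun i => ?_
        exact mul_le_mul_right (lintegral_affine_le hp _ _ hψ.1 _) _
    _ < ∞ := by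
        rw [ENNReal.tsum_mul_right]
        exact ENNReal.mul_lt_top hc (lintegral_rpow_lt_top hp hψ)

/-- The synthesis series converges absolutely at almost every point. -/
theorem ae_summable_synthesis {d : ℕ} {p : ℝ} (hp : 0 < p) (hp1 : p ≤ 1)
    (a : ℕ+ → Matrix (Fin d) (Fin d) ℝ) (b : Matrix (Fin d) (Fin d) ℝ) {ψ : RSpace d → ℂ}
    (hψ : MemLp ψ (ENNReal.ofReal p) volume) (c : EllpSpace d p) :
    ∀ᵐ x, Summable fun i : Index d => ‖c i * affineAtom p (a i.1) b ψ i.2 x‖ := by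
  have hm : AEMeasurable
      (fun x => (∑' i : Index d, ‖c i * affineAtom p (a i.1) b ψ i.2 x‖ₑ) ^ p) volume :=
    (AEMeasurable.tsum fun i =>
      ((aestronglyMeasurable_affine hp _ _ hψ.1 _).const_mul _).enorm).pow_const p
  filter_upwards [ae_lt_top' hm (lintegral_synthesis_lt_top hp hp1 a b hψ c).ne] with x hx
  refine tsum_enorm_ne_top_iff_summable_norm.1 fun h => ?_
  rw [h, ENNReal.top_rpow_of_pos hp] at hx
  exact lt_irrefl _ hx

theorem memLp_synthesisFun {d : ℕ} {p : ℝ} (hp : 0 < p) (hp1 : p ≤ 1)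
    (a : ℕ+ → Matrix (Fin d) (Fin d) ℝ) (b : Matrix (Fin d) (Fin d) ℝ) {ψ : RSpace d → ℂ}
    (hψ : MemLp ψ (ENNReal.ofReal p) volume) (c : EllpSpace d p) :
    MemLp (synthesisFun p a b ψ (fun i => c i)) (ENNReal.ofReal p) volume := by
  constructor
  · refine aestronglyMeasurable_of_tendsto_ae (u := (atTop : Filter (Finset (Index d))))
      (f := fun s x => ∑ i ∈ s, c i * affineAtom p (a i.1) b ψ i.2 x) (fun s => ?_) ?_
    · exact Finset.aestronglyMeasurable_fun_sum s fun i _ =>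
        (aestronglyMeasurable_affine hp _ _ hψ.1 _).const_mul _
    · filter_upwards [ae_summable_synthesis hp hp1 a b hψ c] with x hx
      exact hx.of_norm.hasSum
  · rw [eLpNorm_lt_top_iff_lintegral_rpow_enorm_lt_top (by simpa using hp)
      ENNReal.ofReal_ne_top, ENNReal.toReal_ofReal hp.le]
    refine lt_of_le_of_lt (lintegral_mono fun x => ?_)
      (lintegral_synthesis_lt_top hp hp1 a b hψ c)
    exact ENNReal.rpow_le_rpow enorm_tsum_le_tsum_enorm hp.le

theorem lp_norm_rpow {d : ℕ} {p : ℝ} (hp : 0 < p) (f : LpSpace d p) :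
    ENNReal.ofReal (‖f‖ ^ p) = ∫⁻ x, ‖f x‖ₑ ^ p := by
  rw [← ENNReal.ofReal_rpow_of_nonneg (by rw [Lp.norm_def]; exact ENNReal.toReal_nonneg) hp.le,
    Lp.norm_def, ENNReal.ofReal_toReal (Lp.eLpNorm_ne_top f),
    eLpNorm_eq_lintegral_rpow_enorm_toReal (by simpa using hp) ENNReal.ofReal_ne_top,
    ENNReal.toReal_ofReal hp.le, ← ENNReal.rpow_mul, one_div, inv_mul_cancel₀ hp.ne',
    ENNReal.rpow_one]

theorem lp_norm_add_rpow_le {d : ℕ} {p : ℝ} (hp : 0 < p) (hp1 : p ≤ 1) (f g : LpSpace d p) :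
    ‖f + g‖ ^ p ≤ ‖f‖ ^ p + ‖g‖ ^ p := by
  have hn : ∀ h : LpSpace d p, 0 ≤ ‖h‖ ^ p := fun h =>
    Real.rpow_nonneg (by rw [Lp.norm_def]; exact ENNReal.toReal_nonneg) _
  rw [← ENNReal.ofReal_le_ofReal_iff (add_nonneg (hn f) (hn g)),
    ENNReal.ofReal_add (hn f) (hn g), lp_norm_rpow hp, lp_norm_rpow hp, lp_norm_rpow hp,
    ← lintegral_add_left' ((Lp.aestronglyMeasurable f).enorm.pow_const p)]
  refine lintegral_mono_ae ?_
  filter_upwards [Lp.coeFn_add f g] with x hx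
  rw [hx, Pi.add_apply]
  exact (ENNReal.rpow_le_rpow (enorm_add_le _ _) hp.le).trans
    (ENNReal.rpow_add_le_add_rpow _ _ hp.le hp1)

theorem ellp_norm_add_rpow_le {d : ℕ} {p : ℝ} (hp : 0 < p) (hp1 : p ≤ 1) (c c' : EllpSpace d p) :
    ‖c + c'‖ ^ p ≤ ‖c‖ ^ p + ‖c'‖ ^ p := by
  have ht : (ENNReal.ofReal p).toReal = p := ENNReal.toReal_ofReal hp.le
  have hs : ∀ e : EllpSpace d p, HasSum (fun i => ‖e i‖ ^ p) (‖e‖ ^ p) := fun e => by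
    have := lp.hasSum_norm (p := ENNReal.ofReal p) (by rwa [ht]) e
    rwa [ht] at this
  refine hasSum_le (fun i => ?_) (hs (c + c')) ((hs c).add (hs c'))
  rw [lp.coeFn_add, Pi.add_apply]
  refine (Real.rpow_le_rpow (norm_nonneg _) (norm_add_le _ _) hp.le).trans ?_
  exact Real.rpow_add_le_add_rpow (norm_nonneg _) (norm_nonneg _) hp.le hp1

end Helpers

/-- The metric `d_p(f, g) = ‖f - g‖_p^p` on `L^p(ℝ^d)`, for `0 < p ≤ 1`. -/
@[reducible] def lpMetric (d : ℕ) {p : ℝ} (hp : 0 < p) (hp1 : p ≤ 1) :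
    MetricSpace (LpSpace d p) where
  dist f g := ‖f - g‖ ^ p
  dist_self f := by simp [hp.ne']
  dist_comm f g := by rw [← neg_sub, Lp.norm_neg]
  dist_triangle f g h := by
    rw [← sub_add_sub_cancel f g h]
    exact lp_norm_add_rpow_le hp hp1 _ _
  eq_of_dist_eq_zero {f g} h := by
    have h0 : (0 : ℝ) ≤ ‖f - g‖ := by rw [Lp.norm_def]; exact ENNReal.toReal_nonneg
    have h1 : ‖f - g‖ = 0 := ((Real.rpow_eq_zero h0 hp.ne').1 h)
    exact sub_eq_zero.1 ((Lp.norm_eq_zero_iff (by simpa using hp)).1 h1)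

/-- The metric `d(c, c') = ‖c - c'‖_{ℓ^p}^p` on `ℓ^p(ℤ_+ × ℤ^d)`, for `0 < p ≤ 1`. -/
@[reducible] def ellpMetric (d : ℕ) {p : ℝ} (hp : 0 < p) (hp1 : p ≤ 1) :
    MetricSpace (EllpSpace d p) where
  dist c c' := ‖c - c'‖ ^ p
  dist_self c := by simp [hp.ne']
  dist_comm c c' := by rw [← neg_sub, lp.norm_neg]
  dist_triangle c c' c'' := by
    rw [← sub_add_sub_cancel c c' c'']
    exact ellp_norm_add_rpow_le hp hp1 _ _
  eq_of_dist_eq_zero {c c'} h := by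
    have h1 : ‖c - c'‖ = 0 := ((Real.rpow_eq_zero (lp.norm_nonneg' _) hp.ne').1 h)
    exact sub_eq_zero.1 (lp.norm_eq_zero_iff.1 h1)

/-- The synthesis operator `S : ℓ^p(ℤ_+ × ℤ^d) → L^p(ℝ^d)`, `S c = ∑_{j,k} c_{j,k} ψ_{j,k}`, with
dilation matrices `a_j`, translation matrix `b` and synthesizer `ψ ∈ L^p`, for `0 < p ≤ 1`. -/
def synthesis {d : ℕ} {p : ℝ} (hp : 0 < p) (hp1 : p ≤ 1)
    (a : ℕ+ → Matrix (Fin d) (Fin d) ℝ) (b : Matrix (Fin d) (Fin d) ℝ) (ψ : RSpace d → ℂ)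
    (hψ : MemLp ψ (ENNReal.ofReal p) volume) (c : EllpSpace d p) : LpSpace d p :=
  (memLp_synthesisFun hp hp1 a b hψ c).toLp _

/-- A map `ℓ^p(ℤ_+ × ℤ^d) → L^p(ℝ^d)` is open for the topologies of the metrics
`‖c - c'‖_{ℓ^p}^p` and `‖f - g‖_p^p`. -/
def IsOpenSynthesis {d : ℕ} {p : ℝ} (hp : 0 < p) (hp1 : p ≤ 1)
    (S : EllpSpace d p → LpSpace d p) : Prop :=
  letI := ellpMetric d hp hp1
  letI := lpMetric d hp hp1
  IsOpenMap S

end AffineSynthesis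

end

open AffineSynthesis

/-! Since `p < 1`, the map `v ↦ |v|^p` is subadditive, so errors add in p-th powers and `S` is a
bounded additive map. It therefore suffices to find `θ < 1` and `K` such that every `f` is
approximated by some `S c` with error at most `θ‖f‖^p` and `‖c‖^p ≤ K‖f‖^p`. Applying this
repeatedly to the residuals and summing a geometric series gives an exact preimage with a linear
bound, and openness follows by additivity (`exists_synthesis_eq_of_approx`,
`isOpenSynthesis_of_bounded_preimage`).

The approximation uses a single fine scale. Put `B = N • b`, let `Φ` be the periodization of `ψ ∘
B`, and set `D = a_j⁻¹ B`. Replace `f` by a continuous compactly supported `g` and sample it on the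
lattice `D ℤ^d`, with `u m = g (D m)`. At `x = D (y + m)`, with `y` in the unit cube, the series `∑
t u_k ψ(a_j x - B k)` equals `∑ t u_{m-l} ψ(B (y + l))`. As `D → 0`, neighbouring samples agree and
this is close to `t g(x) Φ(y)`. The error is then close to `θ‖g‖^p`, where `θ = ∫ |1 - tΦ|^p` over
the cube (`lintegral_sub_sampled_le`, `exists_synthesis_approx`). The coefficients cost about `|t|^p
|det B|⁻¹ ‖f‖^p`, which does not involve the dilations.

It remains to choose `N` and `t` with `θ < 1` (`exists_contraction`). Some `N` makes `Φ` nontrivial.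
Suppose the negative part of `ψ` is the bounded, compactly supported one, so that `Φ` is bounded
below. If `∫ Φ > 0`, a small `t > 0` works to first order. If `∫ Φ ≤ 0`, a small `t < 0` makes `1 -
tΦ` nonnegative, and strict concavity of `v ↦ v^p` gives the strict inequality. The other sign case
follows by negating `ψ` and `t`. -/

open AffineSynthesis

/-! ### Tiling by lattice cells and linear changes of variables -/

/-- The half-open cube `[-1/2, 1/2)^d`. -/
def centeredCube (d : ℕ) : Set (RSpace d) := {y | ∀ i, -(1 / 2) ≤ y i ∧ y i < 1 / 2}

theorem measurableSet_centeredCube (d : ℕ) : MeasurableSet (centeredCube d) := by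
  have : centeredCube d = ⋂ i, {y : RSpace d | -(1 / 2) ≤ y i ∧ y i < 1 / 2} := by
    ext; simp [centeredCube]
  rw [this]
  refine MeasurableSet.iInter fun i => ?_
  have h : Measurable fun y : RSpace d => y i := by fun_prop
  exact (measurableSet_le measurable_const h).inter (measurableSet_lt h measurable_const)

theorem volume_centeredCube (d : ℕ) : volume (centeredCube d) = 1 := by
  have h2 : centeredCube d = (WithLp.ofLp : RSpace d → _) ⁻¹'
      (Set.univ.pi fun _ : Fin d => Set.Ico (-(1 / 2) : ℝ) (1 / 2)) := by
    ext; simp [centeredCube]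
  rw [h2, (PiLp.volume_preserving_ofLp (Fin d)).measure_preimage
    (MeasurableSet.univ_pi fun _ => measurableSet_Ico).nullMeasurableSet, Real.volume_pi_Ico]
  norm_num

theorem latticePoint_apply {d : ℕ} (k : Fin d → ℤ) (i : Fin d) : latticePoint k i = k i := rfl

theorem latticePoint_sub {d : ℕ} (k l : Fin d → ℤ) :
    latticePoint (k - l) = latticePoint k - latticePoint l := by
  ext i; simp [latticePoint_apply]

theorem latticePoint_zero {d : ℕ} : latticePoint (0 : Fin d → ℤ) = 0 := by
  ext i; simp [latticePoint_apply]

/-- The lattice point whose translate of the centered cube contains `x`. -/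
noncomputable def nearestLattice {d : ℕ} (x : RSpace d) : Fin d → ℤ := fun i => ⌊x i + 1 / 2⌋

theorem sub_mem_centeredCube_iff {d : ℕ} (x : RSpace d) (k : Fin d → ℤ) :
    x - latticePoint k ∈ centeredCube d ↔ nearestLattice x = k := by
  rw [funext_iff]
  refine forall_congr' fun i => ?_
  rw [nearestLattice, Int.floor_eq_iff, PiLp.sub_apply, latticePoint_apply]
  constructor <;> rintro ⟨h1, h2⟩ <;> constructor <;> linarith

theorem nearestLattice_add {d : ℕ} {y : RSpace d} (hy : y ∈ centeredCube d) (k : Fin d → ℤ) :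
    nearestLattice (y + latticePoint k) = k := by
  rw [← sub_mem_centeredCube_iff, add_sub_cancel_right]
  exact hy

theorem lintegral_eq_tsum_centeredCube {d : ℕ} (h : RSpace d → ℝ≥0∞) :
    ∫⁻ x, h x = ∑' k : Fin d → ℤ, ∫⁻ y in centeredCube d, h (y + latticePoint k) := by
  set s : (Fin d → ℤ) → Set (RSpace d) := fun k => (fun x => x - latticePoint k) ⁻¹' centeredCube d
  have hs : ∀ k, MeasurableSet (s k) := fun k =>
    (measurableSet_centeredCube d).preimage (by fun_prop)
  have hU : ⋃ k, s k = Set.univ := by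
    refine Set.eq_univ_of_forall fun x => Set.mem_iUnion.2 ⟨nearestLattice x, ?_⟩
    exact (sub_mem_centeredCube_iff x _).2 rfl
  have hd : Pairwise (Function.onFun Disjoint s) := by
    intro k l hkl
    refine Set.disjoint_left.2 fun x hk hl => hkl ?_
    rw [← (sub_mem_centeredCube_iff x k).1 hk, ← (sub_mem_centeredCube_iff x l).1 hl]
  rw [← setLIntegral_univ, ← hU, lintegral_iUnion hs hd]
  refine tsum_congr fun k => ?_
  have := (measurePreserving_sub_right (volume : Measure (RSpace d))
    (latticePoint k)).setLIntegral_comp_preimage_emb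
    (MeasurableEquiv.subRight (latticePoint k)).measurableEmbedding
    (fun y => h (y + latticePoint k)) (centeredCube d)
  rw [← this]
  simp [s]

theorem toEuclideanLin_injective {d : ℕ} {D : Matrix (Fin d) (Fin d) ℝ} (hD : D.det ≠ 0) :
    Function.Injective (Matrix.toEuclideanLin D) := by
  have hdet : LinearMap.det (Matrix.toEuclideanLin D) = D.det := LinearMap.det_toLpLin 2 D
  exact (LinearMap.equivOfDetNeZero (Matrix.toEuclideanLin D) (by rwa [hdet])).injective

/-- An invertible linear map is a measurable embedding, so `h` need not be measurable; the same
holds for the cell decomposition. Both can thus be applied directly to integrands containing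
infinite series. -/
theorem lintegral_eq_det_mul {d : ℕ} {D : Matrix (Fin d) (Fin d) ℝ} (hD : D.det ≠ 0)
    (h : RSpace d → ℝ≥0∞) :
    ∫⁻ x, h x = ENNReal.ofReal |D.det| * ∫⁻ y, h (Matrix.toEuclideanLin D y) := by
  have hemb : MeasurableEmbedding (Matrix.toEuclideanLin D) :=
    (LinearMap.continuous_of_finiteDimensional _).measurableEmbedding
      (toEuclideanLin_injective hD)
  rw [← hemb.lintegral_map, map_toEuclideanLin hD, lintegral_smul_measure, smul_eq_mul,
    ← mul_assoc, ← ENNReal.ofReal_mul (abs_nonneg _), ← abs_mul, mul_inv_cancel₀ hD, abs_one,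
    ENNReal.ofReal_one, one_mul]

theorem lintegral_eq_det_mul_tsum {d : ℕ} {D : Matrix (Fin d) (Fin d) ℝ} (hD : D.det ≠ 0)
    (h : RSpace d → ℝ≥0∞) :
    ∫⁻ x, h x = ENNReal.ofReal |D.det| * ∑' k : Fin d → ℤ,
      ∫⁻ y in centeredCube d, h (Matrix.toEuclideanLin D (y + latticePoint k)) := by
  rw [lintegral_eq_det_mul hD, lintegral_eq_tsum_centeredCube]

theorem setLIntegral_centeredCube_const {d : ℕ} (r : ℝ≥0∞) :
    ∫⁻ _ in centeredCube d, r = r := by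
  rw [setLIntegral_const, volume_centeredCube, mul_one]

theorem norm_le_of_mem_centeredCube {d : ℕ} {y : RSpace d} (hy : y ∈ centeredCube d) :
    ‖y‖ ≤ Real.sqrt d := by
  rw [EuclideanSpace.norm_eq]
  refine Real.sqrt_le_sqrt ?_
  calc ∑ i, ‖y i‖ ^ 2 ≤ ∑ _i : Fin d, (1 : ℝ) := Finset.sum_le_sum fun i _ => by
        have h := hy i
        rw [Real.norm_eq_abs, sq_abs]
        nlinarith [h.1, h.2]
    _ = d := by simp

/-! ### Small displacements of a continuous compactly supported function -/

/-- Uniform continuity bounds the integrand by a small constant, and it vanishes off the unit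
thickening of the support, which has finite volume. -/
theorem exists_lintegral_comp_sub_le {d : ℕ} {p : ℝ} (hp : 0 < p) {g : RSpace d → ℂ}
    (hg : Continuous g) (hs : HasCompactSupport g) {ε : ℝ≥0∞} (hε : ε ≠ 0) :
    ∃ δ > 0, ∀ α β : RSpace d → RSpace d, (∀ x, dist (α x) x ≤ δ) → (∀ x, dist (β x) x ≤ δ) →
      ∫⁻ x, ‖g (α x) - g (β x)‖ₑ ^ p ≤ ε := by
  set K := Metric.cthickening 1 (tsupport g) with hK
  have hV : volume K ≠ ∞ := (IsCompact.cthickening hs).measure_lt_top.ne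
  have hKm : MeasurableSet K := Metric.isClosed_cthickening.measurableSet
  obtain ⟨η, hη, hη0⟩ : ∃ η : ℝ, ENNReal.ofReal η ^ p * volume K ≤ ε ∧ 0 < η := by
    have h1 : Tendsto (fun η : ℝ => ENNReal.ofReal η ^ p * volume K) (𝓝[>] 0) (𝓝 0) := by
      have h2 : Tendsto (fun η : ℝ => ENNReal.ofReal η ^ p) (𝓝[>] 0) (𝓝 0) := by
        have h3 : Continuous fun η : ℝ => ENNReal.ofReal η ^ p :=
          (ENNReal.continuous_rpow_const).comp ENNReal.continuous_ofReal
        have h4 := h3.tendsto 0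
        simp only [ENNReal.ofReal_zero, ENNReal.zero_rpow_of_pos hp] at h4
        exact h4.mono_left nhdsWithin_le_nhds
      simpa using ENNReal.Tendsto.mul_const h2 (Or.inr hV)
    exact ((h1.eventually_le_const (pos_iff_ne_zero.2 hε)).and self_mem_nhdsWithin).exists
  obtain ⟨δ, hδ0, hδ⟩ := Metric.uniformContinuous_iff.1
    (hs.uniformContinuous_of_continuous hg) η hη0
  -- The bound `1` keeps displaced points outside the support when `x ∉ K`; two displacements of `δ
  -- / 3` differ by less than `δ`.
  refine ⟨min 1 (δ / 3), by positivity, fun α β hα hβ => ?_⟩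
  have hz : ∀ γ : RSpace d → RSpace d, (∀ x, dist (γ x) x ≤ min 1 (δ / 3)) →
      ∀ x ∉ K, g (γ x) = 0 := by
    intro γ hγ x hx
    by_contra hne
    refine hx (Metric.mem_cthickening_of_dist_le x (γ x) 1 _ (subset_tsupport g hne) ?_)
    rw [dist_comm]
    exact (hγ x).trans (min_le_left _ _)
  calc ∫⁻ x, ‖g (α x) - g (β x)‖ₑ ^ p
      ≤ ∫⁻ x, K.indicator (fun _ => ENNReal.ofReal η ^ p) x := by
        refine lintegral_mono fun x => ?_
        by_cases hx : x ∈ K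
        · rw [Set.indicator_of_mem hx]
          refine ENNReal.rpow_le_rpow ?_ hp.le
          rw [← ofReal_norm, ← dist_eq_norm]
          refine ENNReal.ofReal_le_ofReal (hδ ?_).le
          have h1 := (hα x).trans (min_le_right _ _)
          have h2 := (hβ x).trans (min_le_right _ _)
          have h3 := dist_triangle_right (α x) (β x) x
          linarith
        · simp [hz α hα x hx, hz β hβ x hx, hp]
    _ = ENNReal.ofReal η ^ p * volume K := lintegral_indicator_const hKm _
    _ ≤ ε := hη

theorem norm_toEuclideanLin_le {d : ℕ} (D : Matrix (Fin d) (Fin d) ℝ) (x : RSpace d) :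
    ‖Matrix.toEuclideanLin D x‖ ≤ ‖Matrix.toEuclideanCLM (n := Fin d) (𝕜 := ℝ) D‖ * ‖x‖ :=
  (Matrix.toEuclideanCLM (n := Fin d) (𝕜 := ℝ) D).le_opNorm x

/-- Sampling on the cells of a fine lattice. -/
theorem exists_tsum_sample_sub_le {d : ℕ} {p : ℝ} (hp : 0 < p) {g : RSpace d → ℂ}
    (hg : Continuous g) (hs : HasCompactSupport g) {ε : ℝ≥0∞} (hε : ε ≠ 0) (R : ℝ) :
    ∃ δ > 0, ∀ D : Matrix (Fin d) (Fin d) ℝ, D.det ≠ 0 →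
      ‖Matrix.toEuclideanCLM (n := Fin d) (𝕜 := ℝ) D‖ ≤ δ →
      ∀ α β : RSpace d → RSpace d, (∀ y ∈ centeredCube d, ‖α y - y‖ ≤ R ∧ ‖β y - y‖ ≤ R) →
      ENNReal.ofReal |D.det| * ∑' m : Fin d → ℤ, ∫⁻ y in centeredCube d,
        ‖g (Matrix.toEuclideanLin D (α y + latticePoint m))
          - g (Matrix.toEuclideanLin D (β y + latticePoint m))‖ₑ ^ p ≤ ε := by
  obtain ⟨δ, hδ0, hδ⟩ := exists_lintegral_comp_sub_le hp hg hs hε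
  have hR : 0 < |R| + 1 := by positivity
  refine ⟨δ / (|R| + 1), by positivity, fun D hD hDn α β hαβ => ?_⟩
  set E : RSpace d ≃ₗ[ℝ] RSpace d := LinearEquiv.ofInjectiveEndo _ (toEuclideanLin_injective hD)
  have hE : ∀ y, E y = Matrix.toEuclideanLin D y := fun y => rfl
  -- `T γ` applies `γ` inside every cell of the lattice `D ℤ^d`: it sends `D (y + m)` to `D (γ y +
  -- m)`, hence moves no point by more than `‖D‖ |R|`.
  set T : (RSpace d → RSpace d) → RSpace d → RSpace d := fun γ x =>
    E (γ (E.symm x - latticePoint (nearestLattice (E.symm x)))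
      + latticePoint (nearestLattice (E.symm x))) with hT
  have hTy : ∀ γ, ∀ y ∈ centeredCube d, ∀ m, T γ (Matrix.toEuclideanLin D (y + latticePoint m))
      = Matrix.toEuclideanLin D (γ y + latticePoint m) := by
    intro γ y hy m
    simp only [hT, ← hE, LinearEquiv.symm_apply_apply, nearestLattice_add hy, add_sub_cancel_right]
  have hTd : ∀ γ : RSpace d → RSpace d, (∀ y ∈ centeredCube d, ‖γ y - y‖ ≤ R) →
      ∀ x, dist (T γ x) x ≤ δ := by
    intro γ hγ x
    have hy := (sub_mem_centeredCube_iff (E.symm x) _).2 rfl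
    set y := E.symm x - latticePoint (nearestLattice (E.symm x)) with hydef
    have : T γ x - x = Matrix.toEuclideanLin D (γ y - y) := by
      have hx : x = E (y + latticePoint (nearestLattice (E.symm x))) := by simp [hydef]
      conv_lhs => rw [hx, hE, hTy γ y hy]
      rw [← map_sub, add_sub_add_right_eq_sub]
    rw [dist_eq_norm, this]
    calc _ ≤ δ / (|R| + 1) * (|R| + 1) := (norm_toEuclideanLin_le D _).trans
          (mul_le_mul hDn ((hγ y hy).trans ((le_abs_self R).trans (by linarith)))
            (norm_nonneg _) (by positivity))
      _ = δ := by field_simp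
  refine le_trans (le_of_eq ?_)
    (hδ (T α) (T β) (hTd α fun y hy => (hαβ y hy).1) (hTd β fun y hy => (hαβ y hy).2))
  rw [lintegral_eq_det_mul_tsum hD]
  congr 1
  refine tsum_congr fun m => setLIntegral_congr_fun (measurableSet_centeredCube d) fun y hy => ?_
  simp only [hTy _ y hy]

/-! ### Convergence and integrability of the periodization -/

/-- The periodization `∑_l ψ(B(y + l))` over the integer lattice of `ψ ∘ B`. -/
noncomputable def periodization {d : ℕ} (B : Matrix (Fin d) (Fin d) ℝ) (ψ : RSpace d → ℝ)
    (y : RSpace d) : ℝ :=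
  ∑' l : Fin d → ℤ, ψ (Matrix.toEuclideanLin B (y + latticePoint l))

section Periodization

variable {d : ℕ} {B : Matrix (Fin d) (Fin d) ℝ} {ψ : RSpace d → ℝ}

theorem quasiMeasurePreserving_toEuclideanLin (hB : B.det ≠ 0) :
    Measure.QuasiMeasurePreserving (Matrix.toEuclideanLin B) (volume : Measure (RSpace d))
      volume := by
  have h : LinearMap.det (Matrix.toEuclideanLin B) = B.det := LinearMap.det_toLpLin 2 B
  exact Measure.LinearMap.quasiMeasurePreserving _ _ (by rwa [h])

theorem aestronglyMeasurable_comp_lattice (hB : B.det ≠ 0)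
    (hψ : AEStronglyMeasurable ψ volume) (l : Fin d → ℤ) :
    AEStronglyMeasurable (fun y => ψ (Matrix.toEuclideanLin B (y + latticePoint l)))
      (volume.restrict (centeredCube d)) :=
  (hψ.comp_quasiMeasurePreserving ((quasiMeasurePreserving_toEuclideanLin hB).comp
    (measurePreserving_add_right volume (latticePoint l)).quasiMeasurePreserving)).restrict

theorem lintegral_enorm_rpow_comp_lt_top {p : ℝ} (hp : 0 < p) (hB : B.det ≠ 0)
    (hψ : MemLp ψ (ENNReal.ofReal p) volume) :
    ∑' l : Fin d → ℤ, ∫⁻ y in centeredCube d,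
      ‖ψ (Matrix.toEuclideanLin B (y + latticePoint l))‖ₑ ^ p < ∞ := by
  have h := lintegral_rpow_enorm_lt_top_of_eLpNorm_lt_top (by simpa using hp)
    ENNReal.ofReal_ne_top hψ.2
  rw [ENNReal.toReal_ofReal hp.le, lintegral_eq_det_mul_tsum hB] at h
  refine lt_top_iff_ne_top.2 fun htop => ?_
  rw [htop, ENNReal.mul_top (by simpa using hB)] at h
  exact lt_irrefl _ h

theorem lintegral_enorm_comp_lt_top (hB : B.det ≠ 0) (hψ : Integrable ψ volume) :
    ∑' l : Fin d → ℤ, ∫⁻ y in centeredCube d,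
      ‖ψ (Matrix.toEuclideanLin B (y + latticePoint l))‖ₑ < ∞ := by
  have h := lintegral_enorm_rpow_comp_lt_top one_pos hB (p := 1)
    (by simpa using memLp_one_iff_integrable.2 hψ)
  simpa using h

theorem ae_summable_comp_lattice (hB : B.det ≠ 0) (hψ : Integrable ψ volume) :
    ∀ᵐ y ∂(volume.restrict (centeredCube d)), Summable fun l : Fin d → ℤ =>
      ‖ψ (Matrix.toEuclideanLin B (y + latticePoint l))‖ := by
  have hm := fun l => (aestronglyMeasurable_comp_lattice hB hψ.1 l).enorm
  have h := lintegral_enorm_comp_lt_top hB hψ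
  rw [← lintegral_tsum hm] at h
  filter_upwards [ae_lt_top' (AEMeasurable.tsum hm) h.ne] with y hy
  exact tsum_enorm_ne_top_iff_summable_norm.1 hy.ne

theorem integrableOn_periodization (hB : B.det ≠ 0) (hψ : Integrable ψ volume) :
    IntegrableOn (periodization B ψ) (centeredCube d) volume := by
  constructor
  · refine aestronglyMeasurable_of_tendsto_ae (u := (atTop : Filter (Finset (Fin d → ℤ))))
      (f := fun s y => ∑ l ∈ s, ψ (Matrix.toEuclideanLin B (y + latticePoint l)))
      (fun s => Finset.aestronglyMeasurable_fun_sum s fun l _ =>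
        aestronglyMeasurable_comp_lattice hB hψ.1 l) ?_
    filter_upwards [ae_summable_comp_lattice hB hψ] with y hy
    exact hy.of_norm.hasSum
  · refine lt_of_le_of_lt (lintegral_mono fun y => enorm_tsum_le_tsum_enorm) ?_
    rw [lintegral_tsum fun l => (aestronglyMeasurable_comp_lattice hB hψ.1 l).enorm]
    exact lintegral_enorm_comp_lt_top hB hψ

end Periodization

/-! ### Error of the sampled series at one scale -/

/-- The error splits as `(z - u m) + u m (1 - t ∑ φ) - t ∑ (u (m - l) - u m) φ l`: sampling error,
contraction term, and the cost of replacing shifted samples by the local one. Subadditivity of the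
p-th power then separates the terms. -/
theorem enorm_rpow_sub_sampled_le {d : ℕ} {p : ℝ} (hp : 0 < p) (hp1 : p ≤ 1)
    (φ : (Fin d → ℤ) → ℝ) (hφ : Summable fun l => ‖φ l‖) {u : (Fin d → ℤ) → ℂ} {M : ℝ}
    (hu : ∀ k, ‖u k‖ ≤ M) (z : ℂ) (t : ℝ) (m : Fin d → ℤ) :
    ‖z - ∑' l, t * u (m - l) * φ l‖ₑ ^ p ≤ ‖z - u m‖ₑ ^ p +
      (‖u m‖ₑ ^ p * ‖1 - t * ∑' l, φ l‖ₑ ^ p +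
        ‖t‖ₑ ^ p * ∑' l, ‖u (m - l) - u m‖ₑ ^ p * ‖φ l‖ₑ ^ p) := by
  have hφc : Summable fun l => (φ l : ℂ) := by
    refine Summable.of_norm ?_
    simpa using hφ
  have h1 : Summable fun l => u (m - l) * φ l := by
    refine Summable.of_norm_bounded (hφ.mul_left M) fun l => ?_
    rw [norm_mul, Complex.norm_real]
    exact mul_le_mul_of_nonneg_right (hu _) (norm_nonneg _)
  have key : z - ∑' l, t * u (m - l) * φ l = (z - u m) +
      (u m * ((1 - t * ∑' l, φ l : ℝ) : ℂ) + -(t * ∑' l, (u (m - l) - u m) * φ l)) := by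
    have e1 : ∑' l, t * u (m - l) * φ l = t * ∑' l, u (m - l) * φ l := by
      rw [← tsum_mul_left]
      exact tsum_congr fun l => by ring
    have e2 : ∑' l, (u (m - l) - u m) * φ l
        = ∑' l, u (m - l) * φ l - u m * ∑' l, (φ l : ℂ) := by
      rw [← tsum_mul_left, ← h1.tsum_sub (hφc.mul_left _)]
      exact tsum_congr fun l => by ring
    rw [e1, e2]
    push_cast
    ring
  have hadd : ∀ x y : ℂ, ‖x + y‖ₑ ^ p ≤ ‖x‖ₑ ^ p + ‖y‖ₑ ^ p := fun x y =>
    (ENNReal.rpow_le_rpow (enorm_add_le _ _) hp.le).trans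
      (ENNReal.rpow_add_le_add_rpow _ _ hp.le hp1)
  have hre : ∀ r : ℝ, ‖(r : ℂ)‖ₑ = ‖r‖ₑ := fun r => by
    rw [← ofReal_norm, ← ofReal_norm, Complex.norm_real]
  rw [key]
  refine (hadd _ _).trans (add_le_add le_rfl ((hadd _ _).trans (add_le_add ?_ ?_)))
  · rw [enorm_mul, ENNReal.mul_rpow_of_nonneg _ _ hp.le, hre]
  · rw [enorm_neg, enorm_mul, ENNReal.mul_rpow_of_nonneg _ _ hp.le, hre]
    gcongr
    refine (ENNReal.rpow_le_rpow enorm_tsum_le_tsum_enorm hp.le).trans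
      ((rpow_tsum_le hp hp1 _).trans (le_of_eq ?_))
    refine tsum_congr fun l => ?_
    rw [enorm_mul, ENNReal.mul_rpow_of_nonneg _ _ hp.le, hre]

/-- The pointwise splitting is integrated over the cells of `D ℤ^d`. Since `A D = B`, the argument
`A x - B k` at `x = D (y + m)` is `B (y + (m - k))`, so every cell sees the same functions of `y`,
and the sums over `m` decouple from the integrals over the cube in the last two terms. -/
theorem lintegral_sub_sampled_le {d : ℕ} {p : ℝ} (hp : 0 < p) (hp1 : p ≤ 1)
    {A B D : Matrix (Fin d) (Fin d) ℝ} (hD : D.det ≠ 0) (hB : B.det ≠ 0) (hAD : A * D = B)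
    {ψ : RSpace d → ℝ} (hψ : Integrable ψ volume) {u : (Fin d → ℤ) → ℂ} {M : ℝ}
    (hu : ∀ k, ‖u k‖ ≤ M) (g : RSpace d → ℂ) (t : ℝ) :
    ∫⁻ x, ‖g x - ∑' k, t * u k *
        ψ (Matrix.toEuclideanLin A x - Matrix.toEuclideanLin B (latticePoint k))‖ₑ ^ p ≤
      ENNReal.ofReal |D.det| * (∑' m, ∫⁻ y in centeredCube d,
        ‖g (Matrix.toEuclideanLin D (y + latticePoint m)) - u m‖ₑ ^ p) +
      (ENNReal.ofReal |D.det| * ∑' m, ‖u m‖ₑ ^ p) *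
        (∫⁻ y in centeredCube d, ‖1 - t * periodization B ψ y‖ₑ ^ p) +
      ‖t‖ₑ ^ p * ∑' l, (ENNReal.ofReal |D.det| * ∑' m, ‖u (m - l) - u m‖ₑ ^ p) *
        ∫⁻ y in centeredCube d, ‖ψ (Matrix.toEuclideanLin B (y + latticePoint l))‖ₑ ^ p := by
  have hψm := fun l => ((aestronglyMeasurable_comp_lattice hB hψ.1 l).enorm.pow_const p)
  have hΦm : AEMeasurable (fun y => ‖1 - t * periodization B ψ y‖ₑ ^ p)
      (volume.restrict (centeredCube d)) :=
    (aestronglyMeasurable_const.sub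
      ((integrableOn_periodization hB hψ).1.const_mul t)).enorm.pow_const p
  have h3m : ∀ m, AEMeasurable (fun y => ‖t‖ₑ ^ p * ∑' l, ‖u (m - l) - u m‖ₑ ^ p *
      ‖ψ (Matrix.toEuclideanLin B (y + latticePoint l))‖ₑ ^ p)
      (volume.restrict (centeredCube d)) := fun m =>
    (AEMeasurable.tsum fun l => (hψm l).const_mul _).const_mul _
  have hcell : ∀ m : Fin d → ℤ, ∀ y, ∑' k, t * u k *
      (ψ (Matrix.toEuclideanLin A (Matrix.toEuclideanLin D (y + latticePoint m))
        - Matrix.toEuclideanLin B (latticePoint k)) : ℂ)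
      = ∑' l, t * u (m - l) * (ψ (Matrix.toEuclideanLin B (y + latticePoint l)) : ℂ) := by
    intro m y
    have hcomp : Matrix.toEuclideanLin A (Matrix.toEuclideanLin D (y + latticePoint m))
        = Matrix.toEuclideanLin B (y + latticePoint m) := by
      rw [← hAD]
      simp [Matrix.toLpLin_apply]
    -- Reindex by `k = m - l`.
    rw [← (Equiv.subLeft m).tsum_eq, hcomp]
    refine tsum_congr fun l => ?_
    rw [Equiv.subLeft_apply, ← map_sub, latticePoint_sub]
    congr 4
    abel
  have step : ∀ m : Fin d → ℤ, ∫⁻ y in centeredCube d,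
      ‖g (Matrix.toEuclideanLin D (y + latticePoint m)) - ∑' k, t * u k *
        (ψ (Matrix.toEuclideanLin A (Matrix.toEuclideanLin D (y + latticePoint m))
        - Matrix.toEuclideanLin B (latticePoint k)) : ℂ)‖ₑ ^ p ≤
      (∫⁻ y in centeredCube d, ‖g (Matrix.toEuclideanLin D (y + latticePoint m)) - u m‖ₑ ^ p) +
      (‖u m‖ₑ ^ p * (∫⁻ y in centeredCube d, ‖1 - t * periodization B ψ y‖ₑ ^ p) +
      ‖t‖ₑ ^ p * ∑' l, ‖u (m - l) - u m‖ₑ ^ p *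
        ∫⁻ y in centeredCube d,
          ‖ψ (Matrix.toEuclideanLin B (y + latticePoint l))‖ₑ ^ p) := by
    intro m
    have e : ∀ l, ‖u (m - l) - u m‖ₑ ^ p * ∫⁻ y in centeredCube d,
        ‖ψ (Matrix.toEuclideanLin B (y + latticePoint l))‖ₑ ^ p
        = ∫⁻ y in centeredCube d, ‖u (m - l) - u m‖ₑ ^ p *
          ‖ψ (Matrix.toEuclideanLin B (y + latticePoint l))‖ₑ ^ p := fun l =>
      (lintegral_const_mul'' _ (hψm l)).symm
    have h23 : AEMeasurable (fun y => ‖u m‖ₑ ^ p * ‖1 - t * periodization B ψ y‖ₑ ^ p +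
        ‖t‖ₑ ^ p * ∑' l, ‖u (m - l) - u m‖ₑ ^ p *
          ‖ψ (Matrix.toEuclideanLin B (y + latticePoint l))‖ₑ ^ p)
        (volume.restrict (centeredCube d)) := (hΦm.const_mul _).add (h3m m)
    rw [tsum_congr e, ← lintegral_tsum fun l => (hψm l).const_mul _,
      ← lintegral_const_mul'' _ hΦm,
      ← lintegral_const_mul'' _ (AEMeasurable.tsum fun l => (hψm l).const_mul _),
      ← lintegral_add_right' _ (h3m m),
      ← lintegral_add_right' _ h23]
    refine lintegral_mono_ae ?_
    filter_upwards [ae_summable_comp_lattice hB hψ] with y hy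
    rw [hcell]
    exact enorm_rpow_sub_sampled_le hp hp1 _ hy hu _ t m
  rw [lintegral_eq_det_mul_tsum hD]
  refine (mul_le_mul_right (ENNReal.tsum_le_tsum step) _).trans (le_of_eq ?_)
  rw [ENNReal.tsum_add, ENNReal.tsum_add, ENNReal.tsum_mul_right, ENNReal.tsum_mul_left,
    ENNReal.tsum_comm, mul_add, mul_add, add_assoc]
  congr 2
  · rw [mul_assoc]
  · rw [mul_left_comm, ← ENNReal.tsum_mul_left]
    congr 1
    refine tsum_congr fun l => ?_
    rw [ENNReal.tsum_mul_right, mul_assoc]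

/-! ### Vanishing of the sampling errors as the lattice is refined -/

section Sampling

variable {d : ℕ} {p : ℝ} {D : ℕ+ → Matrix (Fin d) (Fin d) ℝ} {g : RSpace d → ℂ}

theorem tendsto_tsum_sample_sub (hp : 0 < p) (hD : ∀ j, (D j).det ≠ 0)
    (hlim : Tendsto (fun j => ‖Matrix.toEuclideanCLM (n := Fin d) (𝕜 := ℝ) (D j)‖) atTop (𝓝 0))
    (hg : Continuous g) (hs : HasCompactSupport g) (α β : RSpace d → RSpace d) (R : ℝ)
    (hαβ : ∀ y ∈ centeredCube d, ‖α y - y‖ ≤ R ∧ ‖β y - y‖ ≤ R) :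
    Tendsto (fun j => ENNReal.ofReal |(D j).det| * ∑' m : Fin d → ℤ,
      ∫⁻ y in centeredCube d, ‖g (Matrix.toEuclideanLin (D j) (α y + latticePoint m))
        - g (Matrix.toEuclideanLin (D j) (β y + latticePoint m))‖ₑ ^ p) atTop (𝓝 0) := by
  refine ENNReal.tendsto_nhds_zero.2 fun ε hε => ?_
  obtain ⟨δ, hδ0, hδ⟩ := exists_tsum_sample_sub_le hp hg hs hε.ne' R
  filter_upwards [hlim.eventually_le_const hδ0] with j hj
  exact hδ (D j) (hD j) hj α β hαβ

theorem tendsto_tsum_cell_sub (hp : 0 < p) (hD : ∀ j, (D j).det ≠ 0)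
    (hlim : Tendsto (fun j => ‖Matrix.toEuclideanCLM (n := Fin d) (𝕜 := ℝ) (D j)‖) atTop (𝓝 0))
    (hg : Continuous g) (hs : HasCompactSupport g) :
    Tendsto (fun j => ENNReal.ofReal |(D j).det| * ∑' m : Fin d → ℤ,
      ∫⁻ y in centeredCube d, ‖g (Matrix.toEuclideanLin (D j) (y + latticePoint m))
        - g (Matrix.toEuclideanLin (D j) (latticePoint m))‖ₑ ^ p) atTop (𝓝 0) := by
  have h := tendsto_tsum_sample_sub hp hD hlim hg hs id (fun _ => 0) (Real.sqrt d)
    fun y hy => by simpa using norm_le_of_mem_centeredCube hy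
  simpa using h

theorem tendsto_tsum_shift_sub (hp : 0 < p) (hD : ∀ j, (D j).det ≠ 0)
    (hlim : Tendsto (fun j => ‖Matrix.toEuclideanCLM (n := Fin d) (𝕜 := ℝ) (D j)‖) atTop (𝓝 0))
    (hg : Continuous g) (hs : HasCompactSupport g) (l : Fin d → ℤ) :
    Tendsto (fun j => ENNReal.ofReal |(D j).det| * ∑' m : Fin d → ℤ,
      ‖g (Matrix.toEuclideanLin (D j) (latticePoint (m - l)))
        - g (Matrix.toEuclideanLin (D j) (latticePoint m))‖ₑ ^ p) atTop (𝓝 0) := by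
  -- Maps constant on the cell turn the integrals over the unit-volume cube into differences of
  -- lattice samples.
  have h := tendsto_tsum_sample_sub hp hD hlim hg hs (fun _ => -latticePoint l) (fun _ => 0)
    (‖latticePoint l‖ + Real.sqrt d) fun y hy => by
      have hy' := norm_le_of_mem_centeredCube hy
      constructor
      · refine (norm_sub_le _ _).trans ?_
        rw [norm_neg]
        linarith
      · rw [zero_sub, norm_neg]
        linarith [norm_nonneg (latticePoint l)]
  refine h.congr fun j => ?_
  congr 1
  refine tsum_congr fun m => ?_
  rw [setLIntegral_centeredCube_const, latticePoint_sub, zero_add, neg_add_eq_sub]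

theorem tsum_sample_le (hp : 0 < p) (hp1 : p ≤ 1) {E : Matrix (Fin d) (Fin d) ℝ} (hE : E.det ≠ 0)
    (hg : Continuous g) :
    ENNReal.ofReal |E.det| * ∑' m : Fin d → ℤ,
      ‖g (Matrix.toEuclideanLin E (latticePoint m))‖ₑ ^ p ≤ (∫⁻ x, ‖g x‖ₑ ^ p) +
        ENNReal.ofReal |E.det| * ∑' m : Fin d → ℤ,
          ∫⁻ y in centeredCube d, ‖g (Matrix.toEuclideanLin E (y + latticePoint m))
            - g (Matrix.toEuclideanLin E (latticePoint m))‖ₑ ^ p := by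
  rw [lintegral_eq_det_mul_tsum hE, ← mul_add, ← ENNReal.tsum_add]
  gcongr with m
  have hc : Continuous (Matrix.toEuclideanLin E) := LinearMap.continuous_of_finiteDimensional _
  have hm : Measurable fun y => ‖g (Matrix.toEuclideanLin E (y + latticePoint m))‖ₑ ^ p := by
    have : Continuous fun y => g (Matrix.toEuclideanLin E (y + latticePoint m)) := by fun_prop
    exact this.measurable.enorm.pow_const p
  rw [← lintegral_add_left hm,
    ← setLIntegral_centeredCube_const (‖g (Matrix.toEuclideanLin E (latticePoint m))‖ₑ ^ p)]
  refine lintegral_mono fun y => ?_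
  refine le_trans (ENNReal.rpow_le_rpow ?_ hp.le) (ENNReal.rpow_add_le_add_rpow _ _ hp.le hp1)
  rw [enorm_sub_rev]
  have := enorm_add_le (g (Matrix.toEuclideanLin E (y + latticePoint m)))
    (g (Matrix.toEuclideanLin E (latticePoint m)) -
      g (Matrix.toEuclideanLin E (y + latticePoint m)))
  rwa [add_sub_cancel] at this

theorem tsum_shift_sub_le (hp : 0 < p) (hp1 : p ≤ 1) (u : (Fin d → ℤ) → ℂ) (l : Fin d → ℤ) :
    ∑' m, ‖u (m - l) - u m‖ₑ ^ p ≤ 2 * ∑' m, ‖u m‖ₑ ^ p := by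
  calc ∑' m, ‖u (m - l) - u m‖ₑ ^ p ≤ ∑' m, (‖u (m - l)‖ₑ ^ p + ‖u m‖ₑ ^ p) :=
        ENNReal.tsum_le_tsum fun m => (ENNReal.rpow_le_rpow (enorm_sub_le) hp.le).trans
          (ENNReal.rpow_add_le_add_rpow _ _ hp.le hp1)
    _ = 2 * ∑' m, ‖u m‖ₑ ^ p := by
        have e : ∑' m, ‖u (m - l)‖ₑ ^ p = ∑' m, ‖u m‖ₑ ^ p :=
          (Equiv.subRight l).tsum_eq fun m => ‖u m‖ₑ ^ p
        rw [ENNReal.tsum_add, e, two_mul]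

/-- The weights `w l` will be the p-masses of `ψ ∘ B` on the cells. Each shift error tends to `0`,
but not uniformly in `l`; dominated convergence for counting measure applies because a shift error
is at most twice the sample mass, which is eventually at most `∫ |g|^p + 1`. -/
theorem eventually_sampled_le (hp : 0 < p) (hp1 : p ≤ 1) (hD : ∀ j, (D j).det ≠ 0)
    (hlim : Tendsto (fun j => ‖Matrix.toEuclideanCLM (n := Fin d) (𝕜 := ℝ) (D j)‖) atTop (𝓝 0))
    (hg : Continuous g) (hs : HasCompactSupport g) (hgp : ∫⁻ x, ‖g x‖ₑ ^ p ≠ ∞)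
    {w : (Fin d → ℤ) → ℝ≥0∞} (hw : ∑' l, w l ≠ ∞) {ε : ℝ≥0∞} (hε : ε ≠ 0) :
    ∀ᶠ j in atTop,
      (ENNReal.ofReal |(D j).det| * ∑' m : Fin d → ℤ,
        ∫⁻ y in centeredCube d, ‖g (Matrix.toEuclideanLin (D j) (y + latticePoint m))
          - g (Matrix.toEuclideanLin (D j) (latticePoint m))‖ₑ ^ p ≤ ε) ∧
      (ENNReal.ofReal |(D j).det| * ∑' m : Fin d → ℤ,
        ‖g (Matrix.toEuclideanLin (D j) (latticePoint m))‖ₑ ^ p ≤ (∫⁻ x, ‖g x‖ₑ ^ p) + ε) ∧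
      (∑' l, (ENNReal.ofReal |(D j).det| * ∑' m : Fin d → ℤ,
        ‖g (Matrix.toEuclideanLin (D j) (latticePoint (m - l)))
          - g (Matrix.toEuclideanLin (D j) (latticePoint m))‖ₑ ^ p) * w l ≤ ε) := by
  have hcell := ENNReal.tendsto_nhds_zero.1 (tendsto_tsum_cell_sub hp hD hlim hg hs)
  have hmass : ∀ {η : ℝ≥0∞}, 0 < η → ∀ᶠ j in atTop,
      ENNReal.ofReal |(D j).det| * ∑' m : Fin d → ℤ,
        ‖g (Matrix.toEuclideanLin (D j) (latticePoint m))‖ₑ ^ p ≤ (∫⁻ x, ‖g x‖ₑ ^ p) + η := by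
    intro η hη
    filter_upwards [hcell η hη] with j hj
    exact (tsum_sample_le hp hp1 (hD j) hg).trans (by gcongr)
  have hshift : Tendsto (fun j => ∑' l, (ENNReal.ofReal |(D j).det| * ∑' m : Fin d → ℤ,
        ‖g (Matrix.toEuclideanLin (D j) (latticePoint (m - l)))
          - g (Matrix.toEuclideanLin (D j) (latticePoint m))‖ₑ ^ p) * w l) atTop (𝓝 0) := by
    have h := tendsto_lintegral_filter_of_dominated_convergence (l := atTop)
      (μ := (Measure.count : Measure (Fin d → ℤ)))
      (F := fun j l => (ENNReal.ofReal |(D j).det| * ∑' m : Fin d → ℤ,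
        ‖g (Matrix.toEuclideanLin (D j) (latticePoint (m - l)))
          - g (Matrix.toEuclideanLin (D j) (latticePoint m))‖ₑ ^ p) * w l)
      (f := fun _ => 0) (fun l => 2 * ((∫⁻ x, ‖g x‖ₑ ^ p) + 1) * w l)
      (Eventually.of_forall fun j => Measurable.of_discrete) ?_ ?_ ?_
    · simpa [lintegral_count] using h
    · filter_upwards [hmass one_pos] with j hj
      refine Eventually.of_forall fun l => ?_
      gcongr ?_ * _
      refine le_trans ?_ (mul_le_mul_right hj 2)
      rw [mul_left_comm]
      gcongr
      exact tsum_shift_sub_le hp hp1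
        (fun m => g (Matrix.toEuclideanLin (D j) (latticePoint m))) l
    · rw [lintegral_count, ENNReal.tsum_mul_left]
      exact ENNReal.mul_ne_top (ENNReal.mul_ne_top (by simp)
        (ENNReal.add_ne_top.2 ⟨hgp, ENNReal.one_ne_top⟩)) hw
    · refine Eventually.of_forall fun l => ?_
      have hwl : w l ≠ ∞ := ne_top_of_le_ne_top hw (ENNReal.le_tsum l)
      simpa using ENNReal.Tendsto.mul_const (tendsto_tsum_shift_sub hp hD hlim hg hs l)
        (Or.inr hwl)
  filter_upwards [hcell ε (pos_iff_ne_zero.2 hε), hmass (pos_iff_ne_zero.2 hε),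
    ENNReal.tendsto_nhds_zero.1 hshift ε (pos_iff_ne_zero.2 hε)] with j h1 h2 h3
  exact ⟨h1, h2, h3⟩

end Sampling

/-! ### Approximation by the synthesis operator at one scale -/

theorem memℓp_of_tsum_enorm_rpow_ne_top {d : ℕ} {p : ℝ} (hp : 0 < p) {c : Index d → ℂ}
    (h : ∑' i, ‖c i‖ₑ ^ p ≠ ∞) : Memℓp c (ENNReal.ofReal p) := by
  have ht : (ENNReal.ofReal p).toReal = p := ENNReal.toReal_ofReal hp.le
  refine (memℓp_gen_iff (by rwa [ht])).2 ?_
  rw [ht]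
  have := ENNReal.summable_toReal h
  refine this.congr fun i => ?_
  rw [← ENNReal.toReal_rpow, toReal_enorm]

theorem ellp_norm_rpow {d : ℕ} {p : ℝ} (hp : 0 < p) (c : EllpSpace d p) :
    ENNReal.ofReal (‖c‖ ^ p) = ∑' i, ‖c i‖ₑ ^ p := by
  have ht : (ENNReal.ofReal p).toReal = p := ENNReal.toReal_ofReal hp.le
  have h := lp.hasSum_norm (p := ENNReal.ofReal p) (by rwa [ht]) c
  rw [ht] at h
  rw [← h.tsum_eq, ENNReal.ofReal_tsum_of_nonneg (fun i => by positivity) h.summable]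
  refine tsum_congr fun i => ?_
  rw [← ENNReal.ofReal_rpow_of_nonneg (norm_nonneg _) hp.le, ofReal_norm]

/-- Realization by the synthesis operator of a series over a sublattice at one scale. -/
theorem exists_synthesisFun_eq_sampled {d : ℕ} {p : ℝ} (hp : 0 < p)
    (a : ℕ+ → Matrix (Fin d) (Fin d) ℝ) (b : Matrix (Fin d) (Fin d) ℝ) (ψ : RSpace d → ℝ)
    (j : ℕ+) (hA : (a j).det ≠ 0) {N : ℕ} (hN : N ≠ 0) {u : (Fin d → ℤ) → ℂ}
    (hu : ∑' k, ‖u k‖ₑ ^ p ≠ ∞) (t : ℝ) :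
    ∃ c : EllpSpace d p,
      (∀ x, synthesisFun p a b (fun y => (ψ y : ℂ)) (fun i => c i) x = ∑' k, t * u k *
        ψ (Matrix.toEuclideanLin (a j) x - Matrix.toEuclideanLin (N • b) (latticePoint k))) ∧
      ∑' i, ‖c i‖ₑ ^ p = ‖t‖ₑ ^ p * ENNReal.ofReal |(a j).det|⁻¹ * ∑' k, ‖u k‖ₑ ^ p := by
  -- The lattice of `N • b` sits in that of `b` as the multiples of `N`, so coefficients vanish off
  -- scale `j` and off these positions.
  set e : (Fin d → ℤ) → Index d := fun k => (j, (N : ℤ) • k) with he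
  have hinj : Function.Injective e := fun k l hkl => by
    have h := congrArg Prod.snd hkl
    funext i
    have hi := congrFun h i
    simpa [he, hN] using hi
  set r : ℝ := |(a j).det| ^ (1 / p) with hr
  have hr0 : 0 < r := Real.rpow_pos_of_pos (abs_pos.2 hA) _
  -- The factor `r⁻¹` cancels the normalization `|det a_j|^(1/p)` of the atoms.
  set v : (Fin d → ℤ) → ℂ := fun k => t * u k * ((r⁻¹ : ℝ) : ℂ) with hv
  have hv0 : ∀ i ∉ Set.range e, Function.extend e v 0 i = 0 := fun i hi => by
    rw [Function.extend_apply' _ _ _ (by simpa using hi)]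
    rfl
  have hsupp : ∀ {β : Type} [Zero β] (f : Index d → β),
      (∀ i, Function.extend e v 0 i = 0 → f i = 0) → Function.support f ⊆ Set.range e := by
    intro β _ f hf i hi
    by_contra hne
    exact hi (hf i (hv0 i hne))
  have hnorm : ∑' i, ‖Function.extend e v 0 i‖ₑ ^ p
      = ‖t‖ₑ ^ p * ENNReal.ofReal |(a j).det|⁻¹ * ∑' k, ‖u k‖ₑ ^ p := by
    rw [← hinj.tsum_eq (hsupp _ fun i hi => by simp [hi, hp]), ← ENNReal.tsum_mul_left]
    refine tsum_congr fun k => ?_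
    have h1 : ‖((r⁻¹ : ℝ) : ℂ)‖ₑ ^ p = ENNReal.ofReal |(a j).det|⁻¹ := by
      rw [← ofReal_norm, Complex.norm_real, Real.norm_of_nonneg (by positivity),
        ENNReal.ofReal_rpow_of_nonneg (by positivity) hp.le, Real.inv_rpow hr0.le, hr,
        ← Real.rpow_mul (abs_nonneg _), one_div, inv_mul_cancel₀ hp.ne', Real.rpow_one]
    have h2 : ‖(t : ℂ)‖ₑ = ‖t‖ₑ := by rw [← ofReal_norm, ← ofReal_norm, Complex.norm_real]
    rw [hinj.extend_apply, hv]
    simp only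
    rw [enorm_mul, enorm_mul, ENNReal.mul_rpow_of_nonneg _ _ hp.le,
      ENNReal.mul_rpow_of_nonneg _ _ hp.le, h1, h2]
    ring
  have hne : ∑' i, ‖Function.extend e v 0 i‖ₑ ^ p ≠ ∞ := by
    rw [hnorm]
    refine ENNReal.mul_ne_top (ENNReal.mul_ne_top ?_ ENNReal.ofReal_ne_top) hu
    exact ENNReal.rpow_ne_top_of_nonneg hp.le enorm_ne_top
  refine ⟨⟨Function.extend e v 0, memℓp_of_tsum_enorm_rpow_ne_top hp hne⟩, fun x => ?_, hnorm⟩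
  change ∑' i : Index d, Function.extend e v 0 i *
    affineAtom p (a i.1) b (fun y => (ψ y : ℂ)) i.2 x = _
  rw [← hinj.tsum_eq (hsupp _ fun i hi => by simp [hi])]
  refine tsum_congr fun k => ?_
  have hlat : Matrix.toEuclideanLin b (latticePoint ((N : ℤ) • k))
      = Matrix.toEuclideanLin (N • b) (latticePoint k) := by
    have : latticePoint ((N : ℤ) • k) = N • latticePoint k := by
      ext i
      simp [latticePoint_apply]
    rw [this, map_nsmul, map_nsmul]
    rfl
  rw [hinj.extend_apply, affineAtom, hlat, ← hr, hv]
  have : (r : ℂ) ≠ 0 := by exact_mod_cast hr0.ne'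
  push_cast
  field_simp
  rfl

/-- One step of the approximation: up to an arbitrarily small error, an `L^p` function is
approximated by a synthesis series within the fraction `θ = ∫ |1 - tΦ|^p` of its size, where `Φ`
is the periodization of the synthesizer. -/
theorem exists_synthesis_approx {d : ℕ} {p : ℝ} (hp : 0 < p) (hp1 : p ≤ 1)
    {b : Matrix (Fin d) (Fin d) ℝ} {ψ : RSpace d → ℝ} {N : ℕ} (hN : N ≠ 0)
    (hB : (N • b).det ≠ 0) (hψp : MemLp ψ (ENNReal.ofReal p) volume) (hψ1 : Integrable ψ volume)
    (t : ℝ) (hθ : ∫⁻ y in centeredCube d, ‖1 - t * periodization (N • b) ψ y‖ₑ ^ p ≤ 1)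
    {a : ℕ+ → Matrix (Fin d) (Fin d) ℝ} (ha : IsExpanding a) {f : RSpace d → ℂ}
    (hf : MemLp f (ENNReal.ofReal p) volume) {ε : ℝ≥0∞} (hε : ε ≠ 0) :
    ∃ c : EllpSpace d p,
      ∫⁻ x, ‖f x - synthesisFun p a b (fun y => (ψ y : ℂ)) (fun i => c i) x‖ₑ ^ p ≤
        (∫⁻ y in centeredCube d, ‖1 - t * periodization (N • b) ψ y‖ₑ ^ p) *
          (∫⁻ x, ‖f x‖ₑ ^ p) + ε ∧
      ∑' i, ‖c i‖ₑ ^ p ≤ ‖t‖ₑ ^ p * ENNReal.ofReal |(N • b).det|⁻¹ *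
        ((∫⁻ x, ‖f x‖ₑ ^ p) + ε) := by
  -- Only serves to make `η` finite.
  wlog hε1 : ε ≤ 1 generalizing ε
  · obtain ⟨c, h1, h2⟩ := this one_ne_zero le_rfl
    have : (1 : ℝ≥0∞) ≤ ε := (not_le.1 hε1).le
    exact ⟨c, h1.trans (by gcongr), h2.trans (by gcongr)⟩
  set B := N • b with hBdef
  set θ := ∫⁻ y in centeredCube d, ‖1 - t * periodization B ψ y‖ₑ ^ p with hθdef
  set T : ℝ≥0∞ := ‖t‖ₑ ^ p with hT
  have hTtop : T ≠ ∞ := ENNReal.rpow_ne_top_of_nonneg hp.le enorm_ne_top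
  have hadet : ∀ j, (a j).det ≠ 0 := fun j => ((Matrix.isUnit_iff_isUnit_det _).1 (ha.1 j)).ne_zero
  -- Error budget: `η` for replacing `f` by `g`, `η` for sampling, `2θη ≤ 2η` for the excess mass of
  -- the samples, and `Tη` for the shifts.
  set η : ℝ≥0∞ := ε / (5 + T) with hη
  have hη0 : η ≠ 0 := (ENNReal.div_pos hε (ENNReal.add_ne_top.2 ⟨by simp, hTtop⟩)).ne'
  have hηε : (5 + T) * η = ε := ENNReal.mul_div_cancel (by simp)
    (ENNReal.add_ne_top.2 ⟨by simp, hTtop⟩)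
  have hadd : ∀ x y : ℂ, ‖x + y‖ₑ ^ p ≤ ‖x‖ₑ ^ p + ‖y‖ₑ ^ p := fun x y =>
    (ENNReal.rpow_le_rpow (enorm_add_le _ _) hp.le).trans
      (ENNReal.rpow_add_le_add_rpow _ _ hp.le hp1)
  obtain ⟨g, hgs, hfg, hgc, hgp⟩ := hf.exists_hasCompactSupport_eLpNorm_sub_le
    ENNReal.ofReal_ne_top (ε := η ^ (1 / p)) (by simp [hη0, hp.le])
  have hfg' : ∫⁻ x, ‖f x - g x‖ₑ ^ p ≤ η := by
    rw [eLpNorm_eq_lintegral_rpow_enorm_toReal (by simpa using hp) ENNReal.ofReal_ne_top,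
      ENNReal.toReal_ofReal hp.le, ENNReal.rpow_le_rpow_iff (by positivity)] at hfg
    exact hfg
  have hgf : ∫⁻ x, ‖g x‖ₑ ^ p ≤ (∫⁻ x, ‖f x‖ₑ ^ p) + η := by
    calc ∫⁻ x, ‖g x‖ₑ ^ p ≤ ∫⁻ x, (‖f x‖ₑ ^ p + ‖f x - g x‖ₑ ^ p) := by
          refine lintegral_mono fun x => ?_
          have := hadd (f x) (-(f x - g x))
          rwa [enorm_neg, neg_sub, add_sub_cancel] at this
      _ = (∫⁻ x, ‖f x‖ₑ ^ p) + ∫⁻ x, ‖f x - g x‖ₑ ^ p :=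
          lintegral_add_left' (hf.1.enorm.pow_const p) _
      _ ≤ _ := by gcongr
  obtain ⟨M, hM⟩ := hgs.exists_bound_of_continuous hgc
  set D : ℕ+ → Matrix (Fin d) (Fin d) ℝ := fun j => (a j)⁻¹ * B with hDdef
  have hdet : ∀ j, |(D j).det| = |(a j).det|⁻¹ * |B.det| := fun j => by
    rw [hDdef]
    simp only
    rw [Matrix.det_mul, Matrix.det_nonsing_inv, Ring.inverse_eq_inv', abs_mul, abs_inv]
  have hD : ∀ j, (D j).det ≠ 0 := fun j => by
    rw [← abs_pos, hdet]
    exact mul_pos (inv_pos.2 (abs_pos.2 (hadet j))) (abs_pos.2 hB)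
  have hlim : Tendsto (fun j => ‖Matrix.toEuclideanCLM (n := Fin d) (𝕜 := ℝ) (D j)‖) atTop
      (𝓝 0) := by
    have h := ha.2.mul_const ‖Matrix.toEuclideanCLM (n := Fin d) (𝕜 := ℝ) B‖
    rw [zero_mul] at h
    refine squeeze_zero (fun j => norm_nonneg _) (fun j => ?_) h
    rw [hDdef]
    simp only
    rw [map_mul]
    exact norm_mul_le _ _
  obtain ⟨j, h1, h2, h3⟩ := (eventually_sampled_le hp hp1 hD hlim hgc hgs
    (lintegral_rpow_lt_top hp hgp).ne (lintegral_enorm_rpow_comp_lt_top hp hB hψp).ne hη0).exists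
  set u : (Fin d → ℤ) → ℂ := fun m => g (Matrix.toEuclideanLin (D j) (latticePoint m)) with hu
  have hDpos : ENNReal.ofReal |(D j).det| ≠ 0 := by simpa using hD j
  have husum : ∑' k, ‖u k‖ₑ ^ p ≠ ∞ := by
    intro htop
    rw [htop, ENNReal.mul_top hDpos, top_le_iff] at h2
    refine ENNReal.add_ne_top.2 ⟨(lintegral_rpow_lt_top hp hgp).ne, ?_⟩ h2
    exact ENNReal.div_ne_top (ne_top_of_le_ne_top ENNReal.one_ne_top hε1) (by simp)
  obtain ⟨c, hc1, hc2⟩ := exists_synthesisFun_eq_sampled hp a b ψ j (hadet j) hN husum t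
  have hmass : ENNReal.ofReal |(D j).det| * ∑' k, ‖u k‖ₑ ^ p ≤ (∫⁻ x, ‖f x‖ₑ ^ p) + 2 * η :=
    h2.trans ((add_le_add hgf le_rfl).trans (le_of_eq (by ring)))
  refine ⟨c, ?_, ?_⟩
  · have hmain := lintegral_sub_sampled_le hp hp1 (A := a j) (hD j) hB
      (Matrix.mul_nonsing_inv_cancel_left _ _ (isUnit_iff_ne_zero.2 (hadet j))) hψ1
      (u := u) (fun k => hM _) g t
    calc ∫⁻ x, ‖f x - synthesisFun p a b (fun y => (ψ y : ℂ)) (fun i => c i) x‖ₑ ^ p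
        ≤ ∫⁻ x, (‖f x - g x‖ₑ ^ p +
          ‖g x - synthesisFun p a b (fun y => (ψ y : ℂ)) (fun i => c i) x‖ₑ ^ p) := by
          refine lintegral_mono fun x => ?_
          rw [← sub_add_sub_cancel (f x) (g x)]
          exact hadd _ _
      _ = (∫⁻ x, ‖f x - g x‖ₑ ^ p) +
          ∫⁻ x, ‖g x - synthesisFun p a b (fun y => (ψ y : ℂ)) (fun i => c i) x‖ₑ ^ p :=
          lintegral_add_left' ((hf.1.sub hgp.1).enorm.pow_const p) _
      _ ≤ η + (η + ((∫⁻ x, ‖f x‖ₑ ^ p) + 2 * η) * θ + T * η) := by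
          simp_rw [hc1]
          exact add_le_add hfg' (hmain.trans (by gcongr))
      _ = θ * (∫⁻ x, ‖f x‖ₑ ^ p) + (2 + 2 * θ + T) * η := by ring
      _ ≤ θ * (∫⁻ x, ‖f x‖ₑ ^ p) + (5 + T) * η := by
          gcongr
          calc 2 + 2 * θ ≤ 2 + 2 * 1 := by gcongr
            _ ≤ 5 := by norm_num
      _ = _ := by rw [hηε]
  -- The dilation drops out here: `|det a_j|⁻¹` is `|det B|⁻¹` times the cell volume `|det D_j|`,
  -- which turns the sum of samples into a Riemann sum for `∫ |g|^p`.
  · have hDa : ENNReal.ofReal |(a j).det|⁻¹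
        = ENNReal.ofReal |B.det|⁻¹ * ENNReal.ofReal |(D j).det| := by
      rw [← ENNReal.ofReal_mul (by positivity), hdet]
      congr 1
      have := abs_pos.2 hB
      field_simp
    rw [hc2, hDa, mul_assoc, mul_assoc, mul_assoc]
    gcongr
    refine hmass.trans ?_
    gcongr
    rw [← hηε]
    gcongr
    exact le_self_add.trans' (by norm_num)

/-! ### Choosing `t` so that `∫ |1 - tΦ|^p < 1` -/

/-- For `u ≤ 1` this is Bernoulli's inequality. For `u > 1` the left side is at most `u`, which the
extra `2u` absorbs because `p < 1`. -/
theorem abs_one_sub_rpow_le {p : ℝ} (hp : 0 < p) (hp1 : p < 1) (u : ℝ) :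
    |1 - u| ^ p ≤ 1 - p * u + 2 * (Set.Ioi 1).indicator (fun v => v) u := by
  by_cases hu : 1 < u
  · rw [Set.indicator_of_mem (by exact hu), abs_of_neg (by linarith)]
    calc (-(1 - u)) ^ p ≤ u ^ p := Real.rpow_le_rpow (by linarith) (by linarith) hp.le
      _ ≤ u ^ (1 : ℝ) := Real.rpow_le_rpow_of_exponent_le hu.le hp1.le
      _ = u := Real.rpow_one u
      _ ≤ 1 - p * u + 2 * u := by nlinarith
  · rw [Set.indicator_of_notMem (by exact hu), abs_of_nonneg (by linarith), sub_eq_add_neg]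
    have := rpow_one_add_le_one_add_mul_self (s := -u) (by linarith) hp.le hp1.le
    linarith

section Contraction

variable {Ω : Type*} [MeasurableSpace Ω] {μ : Measure Ω} [IsProbabilityMeasure μ]
  {p : ℝ} {Φ : Ω → ℝ}

theorem integrable_abs_one_sub_rpow (hp : 0 < p) (hp1 : p < 1) (hΦ : Integrable Φ μ) (t : ℝ) :
    Integrable (fun y => |1 - t * Φ y| ^ p) μ := by
  have h1 : Integrable (fun y => 1 + |1 - t * Φ y|) μ :=
    (integrable_const 1).add ((integrable_const 1).sub (hΦ.const_mul t)).abs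
  refine h1.mono' ?_ (Eventually.of_forall fun y => ?_)
  · have h2 : AEStronglyMeasurable (fun y => |1 - t * Φ y|) μ :=
      ((integrable_const (1 : ℝ)).sub (hΦ.const_mul t)).abs.1
    exact (h2.aemeasurable.pow_const p).aestronglyMeasurable
  · rw [Real.norm_of_nonneg (by positivity)]
    have h3 : |1 - t * Φ y| ^ p ≤ (1 + |1 - t * Φ y|) ^ p :=
      Real.rpow_le_rpow (abs_nonneg _) (by linarith) hp.le
    refine h3.trans ?_
    have h4 : (1 : ℝ) ≤ 1 + |1 - t * Φ y| := by linarith [abs_nonneg (1 - t * Φ y)]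
    simpa using Real.rpow_le_rpow_of_exponent_le h4 hp1.le

theorem lintegral_enorm_one_sub_rpow_lt_one (hp : 0 < p) (hp1 : p < 1) (hΦ : Integrable Φ μ)
    {t : ℝ} (h : ∫ y, |1 - t * Φ y| ^ p ∂μ < 1) : ∫⁻ y, ‖1 - t * Φ y‖ₑ ^ p ∂μ < 1 := by
  have e : ∀ y, ‖1 - t * Φ y‖ₑ ^ p = ENNReal.ofReal (|1 - t * Φ y| ^ p) := fun y => by
    rw [← ENNReal.ofReal_rpow_of_nonneg (abs_nonneg _) hp.le, ← ofReal_norm, Real.norm_eq_abs]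
  simp_rw [e]
  rw [← ofReal_integral_eq_lintegral_ofReal (integrable_abs_one_sub_rpow hp hp1 hΦ t)
    (Eventually.of_forall fun y => by positivity)]
  exact ENNReal.ofReal_lt_one.2 h

/-- With `t = 1 / (n + 1)`, the first-order gain `p t ∫ Φ` beats the loss `2 t ∫_{Φ > 1/t} Φ`, since
the tail integral tends to `0`. No lower bound on `Φ` is needed. -/
theorem exists_lintegral_rpow_lt_one_of_integral_pos (hp : 0 < p) (hp1 : p < 1)
    (hΦ : Integrable Φ μ) (hpos : 0 < ∫ y, Φ y ∂μ) :
    ∃ t : ℝ, ∫⁻ y, ‖1 - t * Φ y‖ₑ ^ p ∂μ < 1 := by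
  have hm : ∀ n : ℕ, NullMeasurableSet {y | (n : ℝ) + 1 < Φ y} μ := fun n =>
    nullMeasurableSet_lt aemeasurable_const hΦ.1.aemeasurable
  have htail : Tendsto (fun n : ℕ => ∫ y, {y | (n : ℝ) + 1 < Φ y}.indicator Φ y ∂μ) atTop
      (𝓝 0) := by
    have h := tendsto_integral_of_dominated_convergence (μ := μ)
      (F := fun (n : ℕ) y => {y | (n : ℝ) + 1 < Φ y}.indicator Φ y) (f := fun _ => 0)
      (fun y => ‖Φ y‖) (fun n => hΦ.1.indicator₀ (hm n)) hΦ.norm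
      (fun n => Eventually.of_forall fun y => norm_indicator_le_norm_self _ _)
      (Eventually.of_forall fun y => ?_)
    · simpa using h
    · obtain ⟨n₀, hn₀⟩ := exists_nat_gt (Φ y)
      refine tendsto_const_nhds.congr' ?_
      filter_upwards [eventually_ge_atTop n₀] with n hn
      rw [Set.indicator_of_notMem]
      have : (n₀ : ℝ) ≤ n := by exact_mod_cast hn
      simp only [Set.mem_ofPred_eq, not_lt]
      linarith
  obtain ⟨n, hn⟩ := (htail.eventually_lt_const
    (show (0 : ℝ) < p / 2 * ∫ y, Φ y ∂μ by positivity)).exists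
  set t : ℝ := ((n : ℝ) + 1)⁻¹ with ht
  have ht0 : 0 < t := by positivity
  refine ⟨t, lintegral_enorm_one_sub_rpow_lt_one hp hp1 hΦ ?_⟩
  have hb : ∀ y, |1 - t * Φ y| ^ p
      ≤ 1 - p * t * Φ y + 2 * t * {y | (n : ℝ) + 1 < Φ y}.indicator Φ y := by
    intro y
    have h := abs_one_sub_rpow_le hp hp1 (t * Φ y)
    have hiff : 1 < t * Φ y ↔ (n : ℝ) + 1 < Φ y := by
      rw [ht, inv_mul_eq_div, one_lt_div (by positivity)]
    have e : (Set.Ioi (1 : ℝ)).indicator (fun v => v) (t * Φ y)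
        = t * {y | (n : ℝ) + 1 < Φ y}.indicator Φ y := by
      by_cases hy : (n : ℝ) + 1 < Φ y
      · rw [Set.indicator_of_mem (by exact hiff.2 hy), Set.indicator_of_mem (by exact hy)]
      · rw [Set.indicator_of_notMem (s := Set.Ioi (1 : ℝ)) (fun h => hy (hiff.1 h)), Set.indicator_of_notMem (by exact hy),
          mul_zero]
    rw [e] at h
    linarith
  have hi := hΦ.indicator₀ (hm n)
  calc ∫ y, |1 - t * Φ y| ^ p ∂μ
      ≤ ∫ y, (1 - p * t * Φ y + 2 * t * {y | (n : ℝ) + 1 < Φ y}.indicator Φ y) ∂μ :=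
        integral_mono (integrable_abs_one_sub_rpow hp hp1 hΦ t)
          (((integrable_const 1).sub (hΦ.const_mul _)).add (hi.const_mul _)) hb
    _ = 1 - p * t * (∫ y, Φ y ∂μ) + 2 * t * ∫ y, {y | (n : ℝ) + 1 < Φ y}.indicator Φ y ∂μ := by
        have h1 : Integrable (fun y => 1 - p * t * Φ y) μ :=
          (integrable_const 1).sub (hΦ.const_mul _)
        rw [integral_add h1 (hi.const_mul _),
          integral_sub (integrable_const 1) (hΦ.const_mul _), integral_const_mul,
          integral_const_mul]
        simp
    _ < 1 := by nlinarith

/-- Strict Bernoulli gives `(1 + sΦ)^p < 1 + p s Φ` wherever `Φ ≠ 0`, a set of positive measure, and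
the right side has integral at most `1`. -/
theorem exists_lintegral_rpow_lt_one_of_integral_nonpos (hp : 0 < p) (hp1 : p < 1)
    (hΦ : Integrable Φ μ) {M : ℝ} (hM : 0 ≤ M) (hb : ∀ᵐ y ∂μ, -M ≤ Φ y) (h0 : ¬ Φ =ᵐ[μ] 0)
    (hneg : ∫ y, Φ y ∂μ ≤ 0) :
    ∃ t : ℝ, ∫⁻ y, ‖1 - t * Φ y‖ₑ ^ p ∂μ < 1 := by
  -- Small enough that `1 + sΦ ≥ 0`, so the absolute value disappears.
  set s : ℝ := (M + 1)⁻¹ with hs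
  have hs0 : 0 < s := by positivity
  refine ⟨-s, lintegral_enorm_one_sub_rpow_lt_one hp hp1 hΦ ?_⟩
  have hlow : ∀ᵐ y ∂μ, -1 ≤ s * Φ y := by
    filter_upwards [hb] with y hy
    have : s * (M + 1) = 1 := inv_mul_cancel₀ (by positivity)
    nlinarith
  have e : ∀ {y}, -1 ≤ s * Φ y → |1 - -s * Φ y| ^ p = (1 + s * Φ y) ^ p := fun {y} hy => by
    rw [neg_mul, sub_neg_eq_add, abs_of_nonneg (by linarith)]
  have hlt : ∫ y, |1 - -s * Φ y| ^ p ∂μ < ∫ y, (1 + p * (s * Φ y)) ∂μ := by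
    have hi1 : Integrable (fun y => 1 + p * (s * Φ y)) μ :=
      (integrable_const 1).add ((hΦ.const_mul _).const_mul _)
    have hi2 := integrable_abs_one_sub_rpow hp hp1 hΦ (-s)
    have hi3 : Integrable (fun y => 1 + p * (s * Φ y) - |1 - -s * Φ y| ^ p) μ := hi1.sub hi2
    rw [← sub_pos, ← integral_sub hi1 hi2, integral_pos_iff_support_of_nonneg_ae _ hi3,
      pos_iff_ne_zero]
    · refine fun hz => h0 ?_
      filter_upwards [measure_eq_zero_iff_ae_notMem.1 hz, hlow] with y hy hy1
      by_contra hne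
      refine hy ?_
      rw [Function.mem_support, e hy1]
      exact (sub_pos.2 (rpow_one_add_lt_one_add_mul_self hy1 (mul_ne_zero hs0.ne' hne)
        hp hp1)).ne'
    · filter_upwards [hlow] with y hy
      rw [e hy]
      exact sub_nonneg.2 (rpow_one_add_le_one_add_mul_self hy hp.le hp1.le)
  refine hlt.trans_le ?_
  rw [integral_add (integrable_const 1) ((hΦ.const_mul _).const_mul _), integral_const_mul,
    integral_const_mul]
  have : p * (s * ∫ y, Φ y ∂μ) ≤ 0 :=
    mul_nonpos_of_nonneg_of_nonpos hp.le (mul_nonpos_of_nonneg_of_nonpos hs0.le hneg)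
  simpa using this

theorem exists_lintegral_rpow_lt_one (hp : 0 < p) (hp1 : p < 1)
    (hΦ : Integrable Φ μ) {M : ℝ} (hM : 0 ≤ M) (hb : ∀ᵐ y ∂μ, -M ≤ Φ y) (h0 : ¬ Φ =ᵐ[μ] 0) :
    ∃ t : ℝ, ∫⁻ y, ‖1 - t * Φ y‖ₑ ^ p ∂μ < 1 := by
  rcases lt_or_ge 0 (∫ y, Φ y ∂μ) with h | h
  · exact exists_lintegral_rpow_lt_one_of_integral_pos hp hp1 hΦ h
  · exact exists_lintegral_rpow_lt_one_of_integral_nonpos hp hp1 hΦ hM hb h0 h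

end Contraction

/-! ### Lower bound and nontriviality of the periodization -/

/-- Only finitely many lattice translates of the cube have an image under `B` meeting the compact
set that carries the negative part, and each contributes at least `-|M|`. -/
theorem exists_le_periodization {d : ℕ} {B : Matrix (Fin d) (Fin d) ℝ} (hB : B.det ≠ 0)
    {ψ : RSpace d → ℝ} (hψ : Integrable ψ volume)
    (hneg : IsBoundedCompactlySupported fun x => (ψ x)⁻) :
    ∃ M : ℝ, 0 ≤ M ∧ ∀ᵐ y ∂(volume.restrict (centeredCube d)), -M ≤ periodization B ψ y := by
  obtain ⟨⟨M, hM⟩, K, hK, hKz⟩ := hneg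
  set E : RSpace d ≃ₗ[ℝ] RSpace d := LinearEquiv.ofInjectiveEndo _ (toEuclideanLin_injective hB)
  have hE : ∀ y, E y = Matrix.toEuclideanLin B y := fun y => rfl
  obtain ⟨R, hR⟩ := hK.exists_bound_of_continuousOn (f := E.symm)
    (LinearMap.continuous_of_finiteDimensional E.symm.toLinearMap).continuousOn
  -- If `B (y + l) ∈ K`, then `‖l‖ ≤ ‖y + l‖ + ‖y‖ ≤ R + √d`.
  obtain ⟨n, hn⟩ := exists_nat_ge (R + Real.sqrt d)
  set s : Finset (Fin d → ℤ) := Finset.Icc (fun _ => -(n : ℤ)) (fun _ => (n : ℤ)) with hs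
  have hmem : ∀ y ∈ centeredCube d, ∀ l, Matrix.toEuclideanLin B (y + latticePoint l) ∈ K →
      l ∈ s := by
    intro y hy l hl
    have h1 := hR _ hl
    rw [← hE, E.symm_apply_apply] at h1
    have h2 : ‖latticePoint l‖ ≤ n := by
      have h3 := norm_sub_le (y + latticePoint l) y
      rw [add_sub_cancel_left] at h3
      linarith [norm_le_of_mem_centeredCube hy]
    have h4 : ∀ i, |l i| ≤ (n : ℤ) := fun i => by
      have h5 := (PiLp.norm_apply_le (latticePoint l) i).trans h2
      rw [latticePoint_apply, Real.norm_eq_abs] at h5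
      exact_mod_cast h5
    rw [hs, Finset.mem_Icc]
    exact ⟨fun i => (abs_le.1 (h4 i)).1, fun i => (abs_le.1 (h4 i)).2⟩
  have hq : ∀ l : Fin d → ℤ, Measure.QuasiMeasurePreserving
      (fun y => Matrix.toEuclideanLin B (y + latticePoint l)) (volume : Measure (RSpace d))
      volume := fun l => (quasiMeasurePreserving_toEuclideanLin hB).comp
    (measurePreserving_add_right volume (latticePoint l)).quasiMeasurePreserving
  refine ⟨s.card * |M|, by positivity, ?_⟩
  filter_upwards [ae_summable_comp_lattice hB hψ, ae_restrict_mem (measurableSet_centeredCube d),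
    ae_restrict_of_ae (ae_all_iff.2 fun l => (hq l).ae hM),
    ae_restrict_of_ae (ae_all_iff.2 fun l => (hq l).ae hKz)] with y hsum hy h1 h2
  have h3 : HasSum (fun l => if l ∈ s then -|M| else 0) (∑ l ∈ s, if l ∈ s then -|M| else 0) :=
    hasSum_sum_of_ne_finset_zero fun l hl => if_neg hl
  have h4 : ∑ l ∈ s, (if l ∈ s then -|M| else 0) = -(s.card * |M|) := by
    rw [Finset.sum_congr rfl fun l hl => if_pos hl]
    simp
  rw [← h4]
  refine hasSum_le (fun l => ?_) h3 hsum.of_norm.hasSum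
  have h5 : -(ψ (Matrix.toEuclideanLin B (y + latticePoint l)))⁻
      ≤ ψ (Matrix.toEuclideanLin B (y + latticePoint l)) := neg_le.1 (neg_le_negPart _)
  split_ifs with hl
  · have h6 := (le_abs_self _).trans ((h1 l).trans (le_abs_self M))
    linarith
  · rw [h2 l fun h => hl (hmem y hy l h), neg_zero] at h5
    exact h5

theorem det_nsmul_ne_zero {d : ℕ} {b : Matrix (Fin d) (Fin d) ℝ} (hb : b.det ≠ 0) {N : ℕ}
    (hN : N ≠ 0) : (N • b).det ≠ 0 := by
  rw [← Nat.cast_smul_eq_nsmul ℝ, Matrix.det_smul]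
  exact mul_ne_zero (pow_ne_zero _ (by exact_mod_cast hN)) hb

theorem centeredCube_mem_nhds (d : ℕ) : centeredCube d ∈ 𝓝 (0 : RSpace d) := by
  refine eventually_all.2 fun i => ?_
  have h : ContinuousAt (fun y : RSpace d => y i) 0 := by fun_prop
  have h0 : (0 : RSpace d) i ∈ Set.Ioo (-(1 / 2) : ℝ) (1 / 2) := by simp
  filter_upwards [h (isOpen_Ioo.mem_nhds h0)] with y hy
  exact ⟨hy.1.le, hy.2⟩

/-- If the terms sum to zero, the one at `l = 0` is bounded by the sum of the absolute values of the
others. Hence the central cell carries at most half of the L¹ mass. -/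
theorem two_mul_setLIntegral_le_of_periodization_eq_zero {d : ℕ}
    {B : Matrix (Fin d) (Fin d) ℝ} (hB : B.det ≠ 0)
    {ψ : RSpace d → ℝ} (hψ : Integrable ψ volume)
    (h0 : periodization B ψ =ᵐ[volume.restrict (centeredCube d)] 0) :
    2 * ∫⁻ y in centeredCube d, ‖ψ (Matrix.toEuclideanLin B y)‖ₑ
      ≤ ∫⁻ y, ‖ψ (Matrix.toEuclideanLin B y)‖ₑ := by
  have hm := fun l => (aestronglyMeasurable_comp_lattice hB hψ.1 l).enorm
  have hm0 : AEMeasurable (fun y => ‖ψ (Matrix.toEuclideanLin B y)‖ₑ)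
      (volume.restrict (centeredCube d)) := by
    simpa [latticePoint_zero] using hm 0
  rw [lintegral_eq_tsum_centeredCube, ← lintegral_tsum hm, ← lintegral_const_mul'' _ hm0]
  refine lintegral_mono_ae ?_
  filter_upwards [h0, ae_summable_comp_lattice hB hψ] with y hy hs
  set φ : (Fin d → ℤ) → ℝ := fun l => ψ (Matrix.toEuclideanLin B (y + latticePoint l)) with hφ
  have e0 : ψ (Matrix.toEuclideanLin B y) = φ 0 := by simp [hφ, latticePoint_zero]
  have h1 := hs.of_norm.tsum_eq_add_tsum_ite 0
  have h2 : φ 0 = -∑' l, if l = 0 then 0 else φ l := by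
    have : ∑' l, φ l = 0 := hy
    linarith
  have h3 : ‖φ 0‖ₑ ≤ ∑' l, if l = 0 then 0 else ‖φ l‖ₑ := by
    rw [h2, enorm_neg]
    refine enorm_tsum_le_tsum_enorm.trans (le_of_eq (tsum_congr fun l => ?_))
    split_ifs <;> simp
  have h4 : ∑' l, ‖φ l‖ₑ = ‖φ 0‖ₑ + ∑' l, if l = 0 then 0 else ‖φ l‖ₑ := by
    rw [ENNReal.tsum_eq_add_tsum_ite 0]
    congr!
  rw [e0, two_mul]
  exact (add_le_add le_rfl h3).trans h4.ge

/-- The periodization over a sufficiently sparse sublattice is nontrivial. -/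
theorem exists_periodization_nontrivial {d : ℕ} {b : Matrix (Fin d) (Fin d) ℝ} (hb : b.det ≠ 0)
    {ψ : RSpace d → ℝ} (hψ : Integrable ψ volume) (hψ0 : ¬ ψ =ᵐ[volume] 0) :
    ∃ N : ℕ, N ≠ 0 ∧ ¬ periodization (N • b) ψ =ᵐ[volume.restrict (centeredCube d)] 0 := by
  by_contra! hall
  -- `F N` is `|ψ|` cut off to the image of the cube under `N • b`. These images exhaust the space,
  -- yet each would carry at most half of the mass; in the limit `2‖ψ‖₁ ≤ ‖ψ‖₁`.
  set F : ℕ → RSpace d → ℝ≥0∞ := fun N x =>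
    {x | (N : ℝ)⁻¹ • Matrix.toEuclideanLin b⁻¹ x ∈ centeredCube d}.indicator
      (fun x => ‖ψ x‖ₑ) x with hF
  have hms : ∀ N : ℕ, MeasurableSet
      {x : RSpace d | (N : ℝ)⁻¹ • Matrix.toEuclideanLin b⁻¹ x ∈ centeredCube d} := fun N => by
    have hc : Continuous (Matrix.toEuclideanLin b⁻¹) :=
      LinearMap.continuous_of_finiteDimensional _
    have hc' : Continuous fun x : RSpace d => (N : ℝ)⁻¹ • Matrix.toEuclideanLin b⁻¹ x := by
      fun_prop
    exact (measurableSet_centeredCube d).preimage hc'.measurable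
  have hfin : ∫⁻ x, ‖ψ x‖ₑ ≠ ∞ := hψ.2.ne
  have hlim : Tendsto (fun N => ∫⁻ x, F N x) atTop (𝓝 (∫⁻ x, ‖ψ x‖ₑ)) := by
    refine tendsto_lintegral_of_dominated_convergence' (fun x => ‖ψ x‖ₑ)
      (fun N => hψ.1.enorm.indicator (hms N))
      (fun N => Eventually.of_forall fun x => Set.indicator_le_self _ _ x) hfin
      (Eventually.of_forall fun x => ?_)
    have h1 : Tendsto (fun N : ℕ => (N : ℝ)⁻¹ • Matrix.toEuclideanLin b⁻¹ x) atTop (𝓝 0) := by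
      simpa using (tendsto_inv_atTop_nhds_zero_nat (𝕜 := ℝ)).smul_const
        (Matrix.toEuclideanLin b⁻¹ x)
    refine tendsto_const_nhds.congr' ?_
    filter_upwards [h1 (centeredCube_mem_nhds d)] with N hN
    rw [hF]
    simp only
    rw [Set.indicator_of_mem (by exact hN)]
  have hle : ∀ᶠ N in atTop, 2 * ∫⁻ x, F N x ≤ ∫⁻ x, ‖ψ x‖ₑ := by
    filter_upwards [eventually_ne_atTop 0] with N hN
    have hB := det_nsmul_ne_zero hb hN
    rw [lintegral_eq_det_mul hB, lintegral_eq_det_mul hB (fun x => ‖ψ x‖ₑ), mul_left_comm]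
    gcongr
    refine le_trans (le_of_eq ?_)
      (two_mul_setLIntegral_le_of_periodization_eq_zero hB hψ (hall N hN))
    rw [← lintegral_indicator (measurableSet_centeredCube d)]
    congr 1
    refine lintegral_congr fun y => ?_
    have hy : (N : ℝ)⁻¹ • Matrix.toEuclideanLin b⁻¹ (Matrix.toEuclideanLin (N • b) y) = y := by
      have hu : IsUnit b.det := isUnit_iff_ne_zero.2 hb
      have hN' : (N : ℝ) ≠ 0 := by exact_mod_cast hN
      rw [← Nat.cast_smul_eq_nsmul ℝ, map_smul, LinearMap.smul_apply, map_smul, smul_smul,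
        inv_mul_cancel₀ hN', one_smul]
      simp [Matrix.toLpLin_apply, Matrix.nonsing_inv_mul _ hu]
    by_cases hyQ : y ∈ centeredCube d
    · rw [hF, Set.indicator_of_mem hyQ]
      exact Set.indicator_of_mem (by simpa only [Set.mem_ofPred_eq, hy] using hyQ) _
    · rw [hF, Set.indicator_of_notMem hyQ]
      exact Set.indicator_of_notMem (by simpa only [Set.mem_ofPred_eq, hy] using hyQ) _
  have h2 := le_of_tendsto (ENNReal.Tendsto.const_mul hlim (Or.inr (by simp))) hle
  rw [two_mul] at h2
  have h3 : ∫⁻ x, ‖ψ x‖ₑ = 0 := by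
    by_contra hne
    exact (ENNReal.lt_add_right hfin hne).not_ge h2
  refine hψ0 ?_
  filter_upwards [(lintegral_eq_zero_iff' hψ.1.enorm).1 h3] with x hx
  simpa using hx

theorem exists_contraction_of_negPart {d : ℕ} {p : ℝ} (hp : 0 < p) (hp1 : p < 1)
    {b : Matrix (Fin d) (Fin d) ℝ} (hb : b.det ≠ 0) {ψ : RSpace d → ℝ}
    (hψ : Integrable ψ volume) (hψ0 : ¬ ψ =ᵐ[volume] 0)
    (hneg : IsBoundedCompactlySupported fun x => (ψ x)⁻) :
    ∃ N : ℕ, N ≠ 0 ∧ ∃ t : ℝ,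
      ∫⁻ y in centeredCube d, ‖1 - t * periodization (N • b) ψ y‖ₑ ^ p < 1 := by
  obtain ⟨N, hN, hN0⟩ := exists_periodization_nontrivial hb hψ hψ0
  have hB := det_nsmul_ne_zero hb hN
  obtain ⟨M, hM, hMb⟩ := exists_le_periodization hB hψ hneg
  have : IsProbabilityMeasure ((volume : Measure (RSpace d)).restrict (centeredCube d)) :=
    ⟨by rw [Measure.restrict_apply_univ, volume_centeredCube]⟩
  exact ⟨N, hN, exists_lintegral_rpow_lt_one hp hp1 (integrableOn_periodization hB hψ) hM hMb hN0⟩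

/-- The positive part of `ψ` is the negative part of `-ψ`, and changing the signs of both `ψ` and
`t` preserves `tΦ`. -/
theorem exists_contraction {d : ℕ} {p : ℝ} (hp : 0 < p) (hp1 : p < 1)
    {b : Matrix (Fin d) (Fin d) ℝ} (hb : b.det ≠ 0) {ψ : RSpace d → ℝ}
    (hψ : Integrable ψ volume) (hψ0 : ¬ ψ =ᵐ[volume] 0)
    (hψb : IsBoundedCompactlySupported (fun x => (ψ x)⁻) ∨
      IsBoundedCompactlySupported (fun x => (ψ x)⁺)) :
    ∃ N : ℕ, N ≠ 0 ∧ ∃ t : ℝ,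
      ∫⁻ y in centeredCube d, ‖1 - t * periodization (N • b) ψ y‖ₑ ^ p < 1 := by
  rcases hψb with h | h
  · exact exists_contraction_of_negPart hp hp1 hb hψ hψ0 h
  · obtain ⟨N, hN, t, ht⟩ := exists_contraction_of_negPart hp hp1 hb hψ.neg
      (fun h0 => hψ0 (by filter_upwards [h0] with x hx; simpa using hx))
      (by simpa only [Pi.neg_apply, negPart_neg] using h)
    refine ⟨N, hN, -t, ?_⟩
    have e : ∀ y, periodization (N • b) (-ψ) y = -periodization (N • b) ψ y := fun y => tsum_neg
    simpa only [e, mul_neg, neg_mul] using ht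

/-! ### Additivity and boundedness of synthesis, and the iteration -/

section Synthesis

variable {d : ℕ} {p : ℝ}

theorem lp_norm_nonneg (f : LpSpace d p) : 0 ≤ ‖f‖ := by
  rw [Lp.norm_def]
  exact ENNReal.toReal_nonneg

theorem lp_norm_rpow_nonneg (f : LpSpace d p) : 0 ≤ ‖f‖ ^ p :=
  Real.rpow_nonneg (lp_norm_nonneg f) _

theorem ellp_norm_rpow_nonneg (c : EllpSpace d p) : 0 ≤ ‖c‖ ^ p :=
  Real.rpow_nonneg (lp.norm_nonneg' c) _

theorem lp_norm_sub_rpow (hp : 0 < p) (f : LpSpace d p) {g : RSpace d → ℂ}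
    (hg : MemLp g (ENNReal.ofReal p) volume) :
    ENNReal.ofReal (‖f - hg.toLp g‖ ^ p) = ∫⁻ x, ‖f x - g x‖ₑ ^ p := by
  rw [lp_norm_rpow hp]
  refine lintegral_congr_ae ?_
  filter_upwards [Lp.coeFn_sub f (hg.toLp g), hg.coeFn_toLp] with x h1 h2
  rw [h1, Pi.sub_apply, h2]

/-- The space `ℓ^p` is complete: series that converge absolutely converge. -/
theorem exists_ellp_tsum (hp : 0 < p) (hp1 : p ≤ 1) {c : ℕ → EllpSpace d p}
    (hc : Summable fun n => ‖c n‖ ^ p) :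
    ∃ C : EllpSpace d p, ‖C‖ ^ p ≤ ∑' n, ‖c n‖ ^ p ∧
      Tendsto (fun N => ‖C - ∑ n ∈ Finset.range N, c n‖ ^ p) atTop (𝓝 0) := by
  have hsum : ∑' n, ∑' i, ‖c n i‖ₑ ^ p ≠ ∞ := by
    simp_rw [← ellp_norm_rpow hp]
    rw [← ENNReal.ofReal_tsum_of_nonneg (fun n => ellp_norm_rpow_nonneg _) hc]
    exact ENNReal.ofReal_ne_top
  -- For `p ≤ 1`, summability of p-th powers forces absolute summability in each coordinate.
  have hs : ∀ i, Summable fun n => c n i := fun i => by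
    refine Summable.of_norm (tsum_enorm_ne_top_iff_summable_norm.1 fun htop => hsum ?_)
    have h1 := rpow_tsum_le hp hp1 fun n => ‖c n i‖ₑ
    rw [htop, ENNReal.top_rpow_of_pos hp, top_le_iff] at h1
    rw [ENNReal.tsum_comm]
    exact ENNReal.tsum_eq_top_of_eq_top ⟨i, h1⟩
  have htail : ∀ N, ∑' i, ‖(∑' n, c n i) - ∑ n ∈ Finset.range N, c n i‖ₑ ^ p
      ≤ ∑' n, ∑' i, ‖c (n + N) i‖ₑ ^ p := fun N => by
    rw [ENNReal.tsum_comm]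
    refine ENNReal.tsum_le_tsum fun i => ?_
    rw [← (hs i).sum_add_tsum_nat_add N, add_sub_cancel_left]
    exact (ENNReal.rpow_le_rpow enorm_tsum_le_tsum_enorm hp.le).trans (rpow_tsum_le hp hp1 _)
  have hmem : Memℓp (fun i => ∑' n, c n i) (ENNReal.ofReal p) := by
    refine memℓp_of_tsum_enorm_rpow_ne_top hp (ne_top_of_le_ne_top hsum ?_)
    simpa using htail 0
  set C : EllpSpace d p := ⟨fun i => ∑' n, c n i, hmem⟩
  have hle : ∀ N, ‖C - ∑ n ∈ Finset.range N, c n‖ ^ p ≤ ∑' n, ‖c (n + N)‖ ^ p := fun N => by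
    have hcN : Summable fun n => ‖c (n + N)‖ ^ p := (summable_nat_add_iff N).2 hc
    rw [← ENNReal.ofReal_le_ofReal_iff (tsum_nonneg fun n => ellp_norm_rpow_nonneg _),
      ENNReal.ofReal_tsum_of_nonneg (fun n => ellp_norm_rpow_nonneg _) hcN]
    simp_rw [ellp_norm_rpow hp]
    refine le_trans (le_of_eq (tsum_congr fun i => ?_)) (htail N)
    rw [lp.coeFn_sub, Pi.sub_apply, lp.coeFn_sum, Finset.sum_apply]
  refine ⟨C, by simpa using hle 0, ?_⟩
  exact squeeze_zero (fun N => ellp_norm_rpow_nonneg _) hle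
    (tendsto_sum_nat_add fun n => ‖c n‖ ^ p)

variable {a : ℕ+ → Matrix (Fin d) (Fin d) ℝ} {b : Matrix (Fin d) (Fin d) ℝ} {ψ : RSpace d → ℂ}

theorem synthesis_add (hp : 0 < p) (hp1 : p ≤ 1) (hψ : MemLp ψ (ENNReal.ofReal p) volume)
    (c c' : EllpSpace d p) :
    synthesis hp hp1 a b ψ hψ (c + c')
      = synthesis hp hp1 a b ψ hψ c + synthesis hp hp1 a b ψ hψ c' := by
  simp only [synthesis]
  rw [← MemLp.toLp_add, MemLp.toLp_eq_toLp_iff]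
  filter_upwards [ae_summable_synthesis hp hp1 a b hψ c,
    ae_summable_synthesis hp hp1 a b hψ c'] with x h1 h2
  simp only [synthesisFun, Pi.add_apply]
  rw [← h1.of_norm.tsum_add h2.of_norm]
  refine tsum_congr fun i => ?_
  rw [lp.coeFn_add, Pi.add_apply, add_mul]

theorem synthesis_zero (hp : 0 < p) (hp1 : p ≤ 1) (hψ : MemLp ψ (ENNReal.ofReal p) volume) :
    synthesis hp hp1 a b ψ hψ 0 = 0 := by
  have h := synthesis_add (a := a) (b := b) hp hp1 hψ 0 0
  rwa [add_zero, left_eq_add] at h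

theorem norm_synthesis_rpow_le (hp : 0 < p) (hp1 : p ≤ 1)
    (hψ : MemLp ψ (ENNReal.ofReal p) volume) (c : EllpSpace d p) :
    ‖synthesis hp hp1 a b ψ hψ c‖ ^ p ≤ (∫⁻ x, ‖ψ x‖ₑ ^ p).toReal * ‖c‖ ^ p := by
  rw [← ENNReal.ofReal_le_ofReal_iff
    (mul_nonneg ENNReal.toReal_nonneg (ellp_norm_rpow_nonneg c)),
    ENNReal.ofReal_mul ENNReal.toReal_nonneg,
    ENNReal.ofReal_toReal (lintegral_rpow_lt_top hp hψ).ne, ellp_norm_rpow hp, lp_norm_rpow hp,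
    ← ENNReal.tsum_mul_left]
  have hm : ∀ i : Index d, AEMeasurable
      (fun x => ‖affineAtom p (a i.1) b ψ i.2 x‖ₑ ^ p) volume := fun i =>
    (aestronglyMeasurable_affine hp _ _ hψ.1 _).enorm.pow_const p
  calc ∫⁻ x, ‖synthesis hp hp1 a b ψ hψ c x‖ₑ ^ p
      = ∫⁻ x, ‖synthesisFun p a b ψ (fun i => c i) x‖ₑ ^ p := by
        refine lintegral_congr_ae ?_
        filter_upwards [(memLp_synthesisFun hp hp1 a b hψ c).coeFn_toLp] with x hx
        rw [synthesis, hx]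
    _ ≤ ∫⁻ x, ∑' i : Index d, ‖c i‖ₑ ^ p * ‖affineAtom p (a i.1) b ψ i.2 x‖ₑ ^ p := by
        refine lintegral_mono fun x =>
          (ENNReal.rpow_le_rpow enorm_tsum_le_tsum_enorm hp.le).trans
            ((rpow_tsum_le hp hp1 _).trans (le_of_eq ?_))
        simp_rw [enorm_mul, ENNReal.mul_rpow_of_nonneg _ _ hp.le]
    _ = ∑' i : Index d, ‖c i‖ₑ ^ p * ∫⁻ x, ‖affineAtom p (a i.1) b ψ i.2 x‖ₑ ^ p := by
        rw [lintegral_tsum fun i => (hm i).const_mul _]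
        exact tsum_congr fun i => lintegral_const_mul'' _ (hm i)
    _ ≤ ∑' i, (∫⁻ x, ‖ψ x‖ₑ ^ p) * ‖c i‖ₑ ^ p := by
        refine ENNReal.tsum_le_tsum fun i => ?_
        rw [mul_comm]
        exact mul_le_mul_left (lintegral_affine_le hp _ _ hψ.1 _) _

/-- If every function can be approximated within a fixed fraction `θ < 1` of its size, with control
of the coefficients, then synthesis is onto with control of the coefficients. -/
theorem exists_synthesis_eq_of_approx (hp : 0 < p) (hp1 : p ≤ 1)
    (hψ : MemLp ψ (ENNReal.ofReal p) volume) {θ K : ℝ} (hθ0 : 0 ≤ θ) (hθ1 : θ < 1) (hK : 0 ≤ K)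
    (happ : ∀ f : LpSpace d p, ∃ c : EllpSpace d p,
      ‖f - synthesis hp hp1 a b ψ hψ c‖ ^ p ≤ θ * ‖f‖ ^ p ∧ ‖c‖ ^ p ≤ K * ‖f‖ ^ p)
    (f : LpSpace d p) :
    ∃ c : EllpSpace d p, synthesis hp hp1 a b ψ hψ c = f ∧
      ‖c‖ ^ p ≤ K * (1 - θ)⁻¹ * ‖f‖ ^ p := by
  set S := synthesis hp hp1 a b ψ hψ with hS
  choose γ hγ1 hγ2 using happ
  -- Residuals of the successive approximations. The choice `γ` need not be additive; only `S` is.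
  set r : ℕ → LpSpace d p := fun n => (fun g => g - S (γ g))^[n] f with hr
  have hr0 : r 0 = f := rfl
  have hrs : ∀ n, r (n + 1) = r n - S (γ (r n)) := fun n => Function.iterate_succ_apply' _ _ _
  have hrn : ∀ n, ‖r n‖ ^ p ≤ θ ^ n * ‖f‖ ^ p := fun n => by
    induction n with
    | zero => simp [hr0]
    | succ n ih =>
      rw [hrs, pow_succ', mul_assoc]
      exact (hγ1 _).trans (mul_le_mul_of_nonneg_left ih hθ0)
  have hcn : ∀ n, ‖γ (r n)‖ ^ p ≤ θ ^ n * (K * ‖f‖ ^ p) := fun n => by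
    rw [mul_left_comm]
    exact (hγ2 _).trans (mul_le_mul_of_nonneg_left (hrn n) hK)
  have hgeo := (hasSum_geometric_of_lt_one hθ0 hθ1).mul_right (K * ‖f‖ ^ p)
  have hsum : Summable fun n => ‖γ (r n)‖ ^ p :=
    Summable.of_nonneg_of_le (fun n => ellp_norm_rpow_nonneg _) hcn hgeo.summable
  obtain ⟨c, hc, hlim⟩ := exists_ellp_tsum hp hp1 hsum
  have hpart : ∀ N, f = S (∑ n ∈ Finset.range N, γ (r n)) + r N := fun N => by
    induction N with
    | zero => simp [hr0, hS, synthesis_zero]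
    | succ N ih =>
      rw [Finset.sum_range_succ, hS, synthesis_add, ← hS, hrs, add_assoc, add_sub_cancel]
      exact ih
  refine ⟨c, ?_, hc.trans ((hsum.tsum_le_tsum hcn hgeo.summable).trans (le_of_eq ?_))⟩
  · set W := (∫⁻ x, ‖ψ x‖ₑ ^ p).toReal
    have hbound : ∀ N, ‖S c - f‖ ^ p
        ≤ W * ‖c - ∑ n ∈ Finset.range N, γ (r n)‖ ^ p + θ ^ N * ‖f‖ ^ p := fun N => by
      -- Both pieces vanish in the limit: the first by boundedness of `S`, the second by the
      -- geometric decay of the residuals.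
      have e : S c - f = S (c - ∑ n ∈ Finset.range N, γ (r n)) + -r N := by
        have h1 : S c = S (c - ∑ n ∈ Finset.range N, γ (r n))
            + S (∑ n ∈ Finset.range N, γ (r n)) := by
          rw [hS, ← synthesis_add, sub_add_cancel]
        conv_lhs => rw [hpart N, h1]
        abel
      rw [e]
      refine (lp_norm_add_rpow_le hp hp1 _ _).trans ?_
      rw [Lp.norm_neg]
      exact add_le_add (norm_synthesis_rpow_le hp hp1 hψ _) (hrn N)
    have hzero : Tendsto (fun N => W * ‖c - ∑ n ∈ Finset.range N, γ (r n)‖ ^ p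
        + θ ^ N * ‖f‖ ^ p) atTop (𝓝 0) := by
      simpa using (hlim.const_mul W).add
        ((tendsto_pow_atTop_nhds_zero_of_lt_one hθ0 hθ1).mul_const (‖f‖ ^ p))
    have h1 : ‖S c - f‖ ^ p ≤ 0 := ge_of_tendsto' hzero hbound
    have h2 : ‖S c - f‖ = 0 :=
      (Real.rpow_eq_zero (lp_norm_nonneg _) hp.ne').1 (h1.antisymm (lp_norm_rpow_nonneg _))
    exact sub_eq_zero.1 ((Lp.norm_eq_zero_iff (by simpa using hp)).1 h2)
  · rw [hgeo.tsum_eq]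
    ring

/-- By additivity, a point `f` near `S c` is reached from `c + e`, where `e` is a controlled
preimage of the small difference `f - S c`. -/
theorem isOpenSynthesis_of_bounded_preimage (hp : 0 < p) (hp1 : p ≤ 1)
    (hψ : MemLp ψ (ENNReal.ofReal p) volume) {L : ℝ} (hL : 0 ≤ L)
    (h : ∀ f : LpSpace d p, ∃ c : EllpSpace d p,
      synthesis hp hp1 a b ψ hψ c = f ∧ ‖c‖ ^ p ≤ L * ‖f‖ ^ p) :
    IsOpenSynthesis hp hp1 (synthesis hp hp1 a b ψ hψ) := by
  let _ := ellpMetric d hp hp1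
  let _ := lpMetric d hp hp1
  change IsOpenMap (synthesis hp hp1 a b ψ hψ)
  intro U hU
  refine Metric.isOpen_iff.2 ?_
  rintro _ ⟨c, hcU, rfl⟩
  obtain ⟨ε, hε, hball⟩ := Metric.isOpen_iff.1 hU c hcU
  refine ⟨ε / (L + 1), by positivity, fun f hf => ?_⟩
  obtain ⟨e, he, hen⟩ := h (f - synthesis hp hp1 a b ψ hψ c)
  refine ⟨c + e, hball ?_, by rw [synthesis_add, he, add_sub_cancel]⟩
  have hf' : ‖f - synthesis hp hp1 a b ψ hψ c‖ ^ p < ε / (L + 1) := hf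
  change ‖c + e - c‖ ^ p < ε
  rw [add_sub_cancel_left]
  rw [lt_div_iff₀ (by positivity)] at hf'
  nlinarith [lp_norm_rpow_nonneg (f - synthesis hp hp1 a b ψ hψ c)]

end Synthesis

/-! ### Uniform approximation constants and conclusion -/

theorem exists_synthesis_approx_norm {d : ℕ} {p : ℝ} (hp : 0 < p) (hp1 : p < 1)
    {b : Matrix (Fin d) (Fin d) ℝ} (hb : IsUnit b) {ψ : RSpace d → ℝ}
    (hψp : MemLp (fun x => (ψ x : ℂ)) (ENNReal.ofReal p) volume) (hψ1 : Integrable ψ volume)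
    (hψ0 : ¬ ψ =ᵐ[volume] 0)
    (hψb : IsBoundedCompactlySupported (fun x => (ψ x)⁻) ∨
      IsBoundedCompactlySupported (fun x => (ψ x)⁺)) :
    ∃ θ K : ℝ, 0 ≤ θ ∧ θ < 1 ∧ 0 ≤ K ∧
      ∀ a : ℕ+ → Matrix (Fin d) (Fin d) ℝ, IsExpanding a → ∀ f : LpSpace d p,
        ∃ c : EllpSpace d p,
          ‖f - synthesis hp hp1.le a b (fun x => (ψ x : ℂ)) hψp c‖ ^ p ≤ θ * ‖f‖ ^ p ∧
          ‖c‖ ^ p ≤ K * ‖f‖ ^ p := by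
  have hb' : b.det ≠ 0 := ((Matrix.isUnit_iff_isUnit_det _).1 hb).ne_zero
  obtain ⟨N, hN, t, ht⟩ := exists_contraction hp hp1 hb' hψ1 hψ0 hψb
  have hψpr : MemLp ψ (ENNReal.ofReal p) volume := by simpa using hψp.re
  set θ := ∫⁻ y in centeredCube d, ‖1 - t * periodization (N • b) ψ y‖ₑ ^ p with hθ
  set κ : ℝ≥0∞ := ‖t‖ₑ ^ p * ENNReal.ofReal |(N • b).det|⁻¹ with hκ
  have hκtop : κ ≠ ∞ :=
    ENNReal.mul_ne_top (ENNReal.rpow_ne_top_of_nonneg hp.le enorm_ne_top) ENNReal.ofReal_ne_top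
  have hθtop : θ ≠ ∞ := ne_top_of_lt ht
  have hθ1 : θ.toReal < 1 := by
    simpa using (ENNReal.toReal_lt_toReal hθtop ENNReal.one_ne_top).2 ht
  -- Half of the gap below `1` is spent on the additive error, taken as `δ‖f‖^p`; this must be
  -- nonzero, so `f` of norm zero is treated separately.
  set δ : ℝ := (1 - θ.toReal) / 2 with hδ
  have hδ0 : 0 < δ := by linarith
  refine ⟨θ.toReal + δ, κ.toReal * (1 + δ), by positivity, by linarith, by positivity,
    fun a ha f => ?_⟩
  rcases eq_or_lt_of_le (lp_norm_rpow_nonneg f) with hf | hf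
  · refine ⟨0, ?_, ?_⟩
    · rw [synthesis_zero, sub_zero, ← hf, mul_zero]
    · rw [lp.norm_zero, Real.zero_rpow hp.ne', ← hf, mul_zero]
  · obtain ⟨c, h1, h2⟩ := exists_synthesis_approx hp hp1.le hN (det_nsmul_ne_zero hb' hN) hψpr hψ1
      t ht.le ha (Lp.memLp f) (ε := ENNReal.ofReal (δ * ‖f‖ ^ p))
      (by simpa using mul_pos hδ0 hf)
    refine ⟨c, ?_, ?_⟩
    · rw [← ENNReal.ofReal_le_ofReal_iff (by positivity)]
      refine (lp_norm_sub_rpow hp f _).trans_le (h1.trans (le_of_eq ?_))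
      rw [← lp_norm_rpow hp, add_mul, ENNReal.ofReal_add (by positivity) (by positivity),
        ENNReal.ofReal_mul ENNReal.toReal_nonneg, ENNReal.ofReal_toReal hθtop]
    · rw [← ENNReal.ofReal_le_ofReal_iff (by positivity), ellp_norm_rpow hp]
      refine h2.trans (le_of_eq ?_)
      rw [← lp_norm_rpow hp, ← ENNReal.ofReal_add hf.le (by positivity), ← hκ,
        mul_assoc κ.toReal, ENNReal.ofReal_mul ENNReal.toReal_nonneg,
        ENNReal.ofReal_toReal hκtop]
      congr 2
      ring

theorem theorem6 {d : ℕ} {p : ℝ} (hp : 0 < p) (hp1 : p < 1)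
    (b : Matrix (Fin d) (Fin d) ℝ) (hb : IsUnit b)
    (ψ : RSpace d → ℝ)
    (hψp : MemLp (fun x => (ψ x : ℂ)) (ENNReal.ofReal p) volume)
    (hψ1 : Integrable ψ volume)
    (hψ0 : ¬ ψ =ᵐ[volume] 0)
    (hψb : IsBoundedCompactlySupported (fun x => (ψ x)⁻) ∨
      IsBoundedCompactlySupported (fun x => (ψ x)⁺)) :
    ∃ C : ℝ, ∀ a : ℕ+ → Matrix (Fin d) (Fin d) ℝ, IsExpanding a →
      IsOpenSynthesis hp hp1.le (synthesis hp hp1.le a b (fun x => (ψ x : ℂ)) hψp) ∧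
      Function.Surjective (synthesis hp hp1.le a b (fun x => (ψ x : ℂ)) hψp) ∧
      ∀ f : LpSpace d p, ∃ c : EllpSpace d p,
        synthesis hp hp1.le a b (fun x => (ψ x : ℂ)) hψp c = f ∧ ‖c‖ ≤ C * ‖f‖ := by
  obtain ⟨θ, K, hθ0, hθ1, hK, happ⟩ := exists_synthesis_approx_norm hp hp1 hb hψp hψ1 hψ0 hψb
  have hL : 0 ≤ K * (1 - θ)⁻¹ := mul_nonneg hK (inv_nonneg.2 (by linarith))
  -- The iteration bounds p-th powers of norms, hence the root. `θ` and `K` were fixed before `a`,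
  -- so the constant is uniform in the dilations.
  refine ⟨(K * (1 - θ)⁻¹) ^ (1 / p), fun a ha => ?_⟩
  have h := exists_synthesis_eq_of_approx hp hp1.le hψp hθ0 hθ1 hK (happ a ha)
  refine ⟨isOpenSynthesis_of_bounded_preimage hp hp1.le hψp hL h,
    fun f => (h f).imp fun c hc => hc.1, fun f => ?_⟩
  obtain ⟨c, hc, hcn⟩ := h f
  refine ⟨c, hc, ?_⟩
  rw [← Real.rpow_le_rpow_iff (lp.norm_nonneg' c)
    (mul_nonneg (Real.rpow_nonneg hL _) (lp_norm_nonneg f)) hp,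
    Real.mul_rpow (Real.rpow_nonneg hL _) (lp_norm_nonneg f), ← Real.rpow_mul hL, one_div,
    inv_mul_cancel₀ hp.ne', Real.rpow_one]
  exact hcn
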